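/- Let $P=(p_1,\dots,p_n)\in\mathbb R^{d\times n}$ be a projection matrix: its columns are $\mathbb Q$-linearly independent and $\operatorname{rank}_{\mathbb R}P=d$. Let $\mathbb T^n=(\mathbb R/2\pi\mathbb Z)^n$, let $\mathcal A$ be a continuous function on $\mathbb T^n$ with values in the real $d\times d$ matrices, and let $\alpha(x)=\mathcal A(P^Tx)$, $x\in\mathbb R^d$, be the quasiperiodic coefficient with parent function $\mathcal A$. Assume that $\alpha(x)$ is symmetric for every $x$ and that there are constants $C_0,C_1>0$ with $$C_0|\xi|^2\le \xi^T\alpha(x)\xi\le C_1|\xi|^2\qquad\text{for all }x,\xi\in\mathbb R^d$$ (a scalar coefficient is the case where $\alpha$ is a multiple of the identity). Let $(F,G)=|\mathbb T^n|^{-1}\int_{\mathbb T^n}F\overline G\,dy$ be the inner product of the complex space $L^2(\mathbb T^n)$, and let $V=H^1_P(\mathbb T^n)=\{U\in L^2(\mathbb T^n): P\nabla U\in L^2(\mathbb T^n)^d\}$, with $P\nabla U$ taken in the weak sense and with the inner product $(U,W)+(P\nabla U,P\nabla W)$. On $V$ put $$a(U,W)=(\mathcal A\,P\nabla U,P\nabla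 W)+(U,W).$$ For $N\ge 1$ let $V^N=\operatorname{span}\{e^{ik^Ty}: k\in\mathbb Z^n,\ -N/2\le k_j<N/2\ (1\le j\le n)\}$, let $$(F,G)_N=N^{-n}\sum_{j\in\{0,\dots,N-1\}^n}F(y_j)\overline{G(y_j)},\qquad y_j=\tfrac{2\pi}{N}(j_1,\dots,j_n),$$ and put $a_p(U,W)=(\mathcal A\,P\nabla U,P\nabla W)_N+(U,W)_N$ on $V^N$. Then there is exactly one bounded linear operator $K:V\to V$ with $a(KF,W)=(F,W)$ for all $F,W\in V$, and for every $N\ge1$ there is exactly one linear operator $K_N:V^N\to V^N$ with $a_p(K_NF,W)=(F,W)_N$ for all $F,W\in V^N$. Moreover every point of the spectrum of $K$ is approximated by the spectra of the $K_N$: $$\lim_{N\to\infty}\operatorname{dist}\bigl(\gamma,\sigma(K_N)\bigr)=0\qquad\text{for all }\gamma\in\sigma(K).$$ -/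

import Mathlib

open MeasureTheory Filter Topology Matrix
open scoped ContDiff ComplexConjugate Real

noncomputable section

namespace QEO

instance fact_two_pi_pos : Fact (0 < 2 * π) := ⟨Real.two_pi_pos⟩

/-- A projection matrix: its columns are linearly independent over `ℚ` and it has real rank `d`. -/
def IsProjectionMatrix {d n : ℕ} (P : Matrix (Fin d) (Fin n) ℝ) : Prop :=
  LinearIndependent ℚ (fun i : Fin n => (fun j : Fin d => P j i)) ∧ P.rank = d

/-- The torus `(ℝ / 2πℤ)ⁿ`. -/
abbrev Torus (n : ℕ) : Type := Fin n → AddCircle (2 * π)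

/-- The quotient map `ℝⁿ → (ℝ / 2πℤ)ⁿ`. -/
def toTorus {n : ℕ} (x : Fin n → ℝ) : Torus n := fun i => (x i : AddCircle (2 * π))

/-- The normalised measure `|𝕋ⁿ|⁻¹ dy`. -/
abbrev torusMeasure (n : ℕ) : Measure (Torus n) :=
  Measure.pi fun _ : Fin n => AddCircle.haarAddCircle (T := 2 * π)

/-- The Hilbert space `L²(𝕋ⁿ)` for the normalised measure. -/
abbrev L2 (n : ℕ) : Type := Lp ℂ 2 (torusMeasure n)

/-! ### Derivatives on the torus -/

/-- The `i`-th partial derivative of a function on the torus. -/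
def partialDeriv {n : ℕ} (φ : Torus n → ℂ) (i : Fin n) (y : Torus n) : ℂ :=
  deriv (fun t : ℝ => φ (y + toTorus (Pi.single i t))) 0

/-- The classical `P∇φ`, a function with values in `ℂᵈ`. -/
def projGrad {d n : ℕ} (P : Matrix (Fin d) (Fin n) ℝ) (φ : Torus n → ℂ) (y : Torus n) :
    Fin d → ℂ :=
  fun j => ∑ i, (P j i : ℂ) * partialDeriv φ i y

/-- Smooth functions on the torus, i.e. smooth functions on `ℝⁿ` that are `2π`-periodic in
each variable. -/
def IsTestFunction {n : ℕ} (φ : Torus n → ℂ) : Prop :=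
  ContDiff ℝ ∞ (fun x : Fin n → ℝ => φ (toTorus x))

/-- `W` is the weak `P∇U`: integration by parts holds against every smooth test function. -/
def IsWeakProjGrad {d n : ℕ} (P : Matrix (Fin d) (Fin n) ℝ) (U : L2 n) (W : Fin d → L2 n) :
    Prop :=
  ∀ φ : Torus n → ℂ, IsTestFunction φ → ∀ j : Fin d,
    ∫ y, W j y * φ y ∂(torusMeasure n) = - ∫ y, U y * projGrad P φ y j ∂(torusMeasure n)

/-! ### Helper facts: test functions and their derivatives are continuous -/

theorem toTorus_add {n : ℕ} (x z : Fin n → ℝ) : toTorus (x + z) = toTorus x + toTorus z := by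
  funext i
  simp [toTorus]

theorem isOpenQuotientMap_toTorus (n : ℕ) :
    IsOpenQuotientMap (toTorus : (Fin n → ℝ) → Torus n) := by
  have h : IsOpenQuotientMap (fun t : ℝ => (t : AddCircle (2 * π))) :=
    QuotientAddGroup.isOpenQuotientMap_mk
  exact IsOpenQuotientMap.piMap (fun _ => h)

theorem IsTestFunction.continuous {n : ℕ} {φ : Torus n → ℂ} (h : IsTestFunction φ) :
    Continuous φ :=
  (isOpenQuotientMap_toTorus n).isQuotientMap.continuous_iff.2 (ContDiff.continuous h)

theorem partialDeriv_toTorus {n : ℕ} {φ : Torus n → ℂ} (h : IsTestFunction φ) (i : Fin n)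
    (x : Fin n → ℝ) :
    partialDeriv φ i (toTorus x)
      = fderiv ℝ (fun x : Fin n → ℝ => φ (toTorus x)) x (Pi.single i 1) := by
  have hd : DifferentiableAt ℝ (fun x : Fin n → ℝ => φ (toTorus x)) x :=
    (ContDiff.differentiable h (by simp)) x
  rw [← hd.lineDeriv_eq_fderiv]
  unfold partialDeriv lineDeriv
  congr 1
  funext t
  rw [← toTorus_add]
  congr 3
  funext k
  by_cases hk : k = i
  · subst hk; simp
  · simp [hk]

theorem IsTestFunction.continuous_partialDeriv {n : ℕ} {φ : Torus n → ℂ} (h : IsTestFunction φ)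
    (i : Fin n) : Continuous (partialDeriv φ i) := by
  refine (isOpenQuotientMap_toTorus n).isQuotientMap.continuous_iff.2 ?_
  have : partialDeriv φ i ∘ toTorus
      = fun x => fderiv ℝ (fun x : Fin n → ℝ => φ (toTorus x)) x (Pi.single i 1) := by
    funext x
    exact partialDeriv_toTorus h i x
  rw [this]
  exact (ContDiff.continuous_fderiv h (by simp)).clm_apply continuous_const

theorem IsTestFunction.continuous_projGrad {d n : ℕ} (P : Matrix (Fin d) (Fin n) ℝ)
    {φ : Torus n → ℂ} (h : IsTestFunction φ) (j : Fin d) :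
    Continuous (fun y => projGrad P φ y j) := by
  unfold projGrad
  exact continuous_finsetSum _ fun i _ => continuous_const.mul (h.continuous_partialDeriv i)

theorem integrable_mul_of_continuous {n : ℕ} (U : L2 n) {g : Torus n → ℂ} (hg : Continuous g) :
    Integrable (fun y => U y * g y) (torusMeasure n) := by
  have hU : MemLp U 2 (torusMeasure n) := Lp.memLp U
  have hg2 : MemLp g 2 (torusMeasure n) := hg.memLp_of_hasCompactSupport
    (HasCompactSupport.of_compactSpace g)
  exact hU.integrable_mul hg2

theorem integral_add_smul_mul {n : ℕ} (c : ℂ) (U U' : L2 n) {g : Torus n → ℂ}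
    (hg : Continuous g) :
    ∫ y, (c • U + U' : L2 n) y * g y ∂(torusMeasure n)
      = c * ∫ y, U y * g y ∂(torusMeasure n) + ∫ y, U' y * g y ∂(torusMeasure n) := by
  rw [← integral_const_mul, ← integral_add ((integrable_mul_of_continuous U hg).const_mul c)
    (integrable_mul_of_continuous U' hg)]
  refine integral_congr_ae ?_
  filter_upwards [Lp.coeFn_add (c • U) U', Lp.coeFn_smul c U] with y h1 h2
  rw [h1, Pi.add_apply, h2, Pi.smul_apply, smul_eq_mul]
  ring

theorem IsWeakProjGrad.add_smul {d n : ℕ} {P : Matrix (Fin d) (Fin n) ℝ} {U U' : L2 n}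
    {W W' : Fin d → L2 n} (c : ℂ) (h : IsWeakProjGrad P U W) (h' : IsWeakProjGrad P U' W') :
    IsWeakProjGrad P (c • U + U') (fun j => c • W j + W' j) := by
  intro φ hφ j
  rw [integral_add_smul_mul c _ _ hφ.continuous,
    integral_add_smul_mul c _ _ (hφ.continuous_projGrad P j), h φ hφ j, h' φ hφ j]
  ring

theorem IsWeakProjGrad.zero {d n : ℕ} (P : Matrix (Fin d) (Fin n) ℝ) :
    IsWeakProjGrad P (0 : L2 n) (fun _ : Fin d => (0 : L2 n)) := by
  intro φ hφ j
  have h0 : ∀ g : Torus n → ℂ, ∫ y, (0 : L2 n) y * g y ∂(torusMeasure n) = 0 := by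
    intro g
    refine integral_eq_zero_of_ae ?_
    filter_upwards [Lp.coeFn_zero ℂ 2 (torusMeasure n)] with y hy
    rw [hy]
    simp
  rw [h0, h0, neg_zero]

/-! ### The space `H¹_P(𝕋ⁿ)` and the solution operator -/

/-- The space `H¹_P(𝕋ⁿ) = {U ∈ L² : P∇U ∈ (L²)ᵈ}`. An element `U` is stored together with its
weak `P∇U`, i.e. as the pair `(U, P∇U)`, so that the inner product inherited from
`L² × (L²)ᵈ` is `(U, V) + (P∇U, P∇V)`. -/
def H1P {d n : ℕ} (P : Matrix (Fin d) (Fin n) ℝ) :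
    Submodule ℂ (WithLp 2 (L2 n × PiLp 2 (fun _ : Fin d => L2 n))) where
  carrier := {p | IsWeakProjGrad P p.fst (fun j => p.snd j)}
  zero_mem' := IsWeakProjGrad.zero P
  add_mem' := by
    intro p q hp hq
    have h := IsWeakProjGrad.add_smul 1 hp hq
    simp only [one_smul] at h
    exact h
  smul_mem' := by
    intro c p hp
    have h := IsWeakProjGrad.add_smul c hp (IsWeakProjGrad.zero P)
    simp only [add_zero] at h
    exact h

/-- The underlying function `U ∈ L²(𝕋ⁿ)` of an element of `H¹_P(𝕋ⁿ)`. -/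
def toL2 {d n : ℕ} {P : Matrix (Fin d) (Fin n) ℝ} (U : H1P P) : L2 n :=
  (U : WithLp 2 (L2 n × PiLp 2 (fun _ : Fin d => L2 n))).fst

/-- The weak `P∇U` of an element `U` of `H¹_P(𝕋ⁿ)`. -/
def weakGrad {d n : ℕ} {P : Matrix (Fin d) (Fin n) ℝ} (U : H1P P) (j : Fin d) : L2 n :=
  (U : WithLp 2 (L2 n × PiLp 2 (fun _ : Fin d => L2 n))).snd j

/-- `(F, G) = |𝕋ⁿ|⁻¹ ∫ F \bar G dy`. -/
def innerL2 {n : ℕ} (F G : Torus n → ℂ) : ℂ :=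
  ∫ y, F y * conj (G y) ∂(torusMeasure n)

/-- The sesquilinear form `a(U, V) = (𝒜 P∇U, P∇V) + (U, V)` on `H¹_P(𝕋ⁿ)`. -/
def formA {d n : ℕ} (P : Matrix (Fin d) (Fin n) ℝ) (𝒜 : Torus n → Matrix (Fin d) (Fin d) ℝ)
    (U V : H1P P) : ℂ :=
  (∑ j, innerL2 (fun y => ∑ l, (𝒜 y j l : ℂ) * weakGrad U l y) (fun y => weakGrad V j y))
    + innerL2 (fun y => toL2 U y) (fun y => toL2 V y)

/-- `K` is the solution operator: `a(K F, V) = (F, V)` for all `F, V ∈ H¹_P(𝕋ⁿ)`. -/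
def IsSolutionOperator {d n : ℕ} (P : Matrix (Fin d) (Fin n) ℝ)
    (𝒜 : Torus n → Matrix (Fin d) (Fin d) ℝ) (K : H1P P →L[ℂ] H1P P) : Prop :=
  ∀ F V : H1P P, formA P 𝒜 (K F) V = innerL2 (fun y => toL2 F y) (fun y => toL2 V y)

/-! ### The projection method -/

/-- The character `y ↦ exp(i kᵀ y)` of the torus. -/
def character {n : ℕ} (k : Fin n → ℤ) : C(Torus n, ℂ) where
  toFun y := ∏ i, fourier (k i) (y i)
  continuous_toFun := by fun_prop

/-- The frequencies `k ∈ ℤⁿ` with `-N/2 ≤ k_j < N/2` for all `j`. -/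
def freqSet (n N : ℕ) : Set (Fin n → ℤ) :=
  {k | ∀ j, -(N : ℝ) / 2 ≤ (k j : ℝ) ∧ (k j : ℝ) < (N : ℝ) / 2}

/-- The space `V^N` of trigonometric polynomials with frequencies in `freqSet n N`. -/
def trigSpace (n N : ℕ) : Submodule ℂ C(Torus n, ℂ) :=
  Submodule.span ℂ (character '' freqSet n N)

/-- The grid point `(2π j₁/N, …, 2π jₙ/N)`. -/
def gridPoint {n N : ℕ} (j : Fin n → Fin N) : Torus n :=
  toTorus fun i => 2 * π * ((j i : ℕ) : ℝ) / (N : ℝ)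

/-- The discrete inner product `(F, G)_N = N⁻ⁿ ∑_j F(y_j) \bar G(y_j)`. -/
def innerGrid {n : ℕ} (N : ℕ) (F G : Torus n → ℂ) : ℂ :=
  (1 / (N : ℂ) ^ n) * ∑ j : Fin n → Fin N, F (gridPoint j) * conj (G (gridPoint j))

/-- The discrete form `a_p(U, V) = (𝒜 P∇U, P∇V)_N + (U, V)_N`. -/
def formGrid {d n : ℕ} (P : Matrix (Fin d) (Fin n) ℝ)
    (𝒜 : Torus n → Matrix (Fin d) (Fin d) ℝ) (N : ℕ) (U V : Torus n → ℂ) : ℂ :=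
  (∑ j, innerGrid N (fun y => ∑ l, (𝒜 y j l : ℂ) * projGrad P U y l)
      (fun y => projGrad P V y j))
    + innerGrid N U V

/-- `K_N` is the discrete solution operator: `a_p(K_N F, G) = (F, G)_N` for all `F, G ∈ V^N`. -/
def IsDiscreteSolutionOperator {d n : ℕ} (P : Matrix (Fin d) (Fin n) ℝ)
    (𝒜 : Torus n → Matrix (Fin d) (Fin d) ℝ) (N : ℕ)
    (KN : Module.End ℂ (trigSpace n N)) : Prop :=
  ∀ F G : trigSpace n N, formGrid P 𝒜 N ⇑(KN F : C(Torus n, ℂ)) ⇑(G : C(Torus n, ℂ))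
    = innerGrid N ⇑(F : C(Torus n, ℂ)) ⇑(G : C(Torus n, ℂ))

end QEO

end

/-!
Both problems are posed with inner products: `a` makes `K` self-adjoint on `H¹_P`, and `a_p` makes
`K_N` self-adjoint on `V^N`. So `γ ∈ σ(K)` has approximate eigenvectors, which can be taken to be
trigonometric polynomials `φ`, these being dense in `H¹_P`; and in finite dimension the existence of
a vector with residual `K_N φ - γ φ` of relative size `ε` already forces an eigenvalue of `K_N` at
distance `O(ε)` from `γ`. What remains is `K_N φ → K φ`. This is Strang's lemma: on the fixed
trigonometric polynomials the quadrature error in `a_p` tends to zero uniformly in the other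
argument, while the quadrature is exact for products of two elements of `V^N`, so that `(·,·)_N` is
the `L²` inner product there and `a_p` is elliptic uniformly in `N`.

Since the columns of `P` are `ℚ`-linearly independent, the orbit `{Pᵀx}` is dense in the torus, and
symmetry and ellipticity of `α` carry over to its parent function.
-/

noncomputable section

namespace QEO

open scoped InnerProductSpace

section PosDefHermitian

variable {𝕜 X : Type*} [RCLike 𝕜] [AddCommGroup X] [Module 𝕜 X]

/-- A sesquilinear form that is an inner product, conjugate-linear in its first argument. The space
`X` carries no topology here, so that several such forms can be considered on it. -/
structure IsPosDefHermitian (a : X →ₗ⋆[𝕜] X →ₗ[𝕜] 𝕜) : Prop where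
  isSymm : a.IsSymm
  re_pos : ∀ x, x ≠ 0 → 0 < RCLike.re (a x x)

namespace IsPosDefHermitian

variable {a : X →ₗ⋆[𝕜] X →ₗ[𝕜] 𝕜}

/-- The inner product space structure defined by a positive definite Hermitian form. -/
abbrev core (ha : IsPosDefHermitian a) : InnerProductSpace.Core 𝕜 X where
  inner x y := a x y
  conj_inner_symm x y := ha.isSymm.eq y x
  re_inner_nonneg x := by
    rcases eq_or_ne x 0 with rfl | hx
    · simp
    · exact (ha.re_pos x hx).le
  add_left x y z := a.map_add₂ x y z
  smul_left x y c := a.map_smulₛₗ₂ c x y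
  definite x hx := by
    by_contra h
    exact (ha.re_pos x h).ne' (by simp [hx])

variable [FiniteDimensional 𝕜 X]

theorem existsUnique_end (ha : IsPosDefHermitian a) (b : X →ₗ⋆[𝕜] X →ₗ[𝕜] 𝕜) :
    ∃! T : Module.End 𝕜 X, ∀ x y, a y (T x) = b y x := by
  let : NormedAddCommGroup X := ha.core.toNormedAddCommGroup
  let : InnerProductSpace 𝕜 X := .ofCore ha.core.toCore
  have : CompleteSpace X := FiniteDimensional.complete 𝕜 X
  let S : Module.End 𝕜 X :=
    (InnerProductSpace.toDual 𝕜 X).symm.toLinearEquiv.toLinearMap ∘ₛₗ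
      LinearMap.toContinuousLinearMap.toLinearMap ∘ₛₗ b
  have hS : ∀ x y, ⟪y, LinearMap.adjoint S x⟫_𝕜 = b y x := fun x y =>
    (LinearMap.adjoint_inner_right S y x).trans InnerProductSpace.toDual_symm_apply
  exact ⟨LinearMap.adjoint S, hS, fun T hT => LinearMap.ext fun x =>
    ext_inner_left 𝕜 fun y => (hT x y).trans (hS x y).symm⟩

theorem exists_mem_spectrum_near (ha : IsPosDefHermitian a) {T : Module.End 𝕜 X}
    (hT : ∀ x y, a (T x) y = a x (T y)) (γ : 𝕜) {x : X} (hx : x ≠ 0) :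
    ∃ μ ∈ spectrum 𝕜 T,
      ‖γ - μ‖ ^ 2 * RCLike.re (a x x) ≤ RCLike.re (a (T x - γ • x) (T x - γ • x)) := by
  let : NormedAddCommGroup X := ha.core.toNormedAddCommGroup
  let : InnerProductSpace 𝕜 X := .ofCore ha.core.toCore
  have hsymm : T.IsSymmetric := hT
  have : Nonempty (Fin (Module.finrank 𝕜 X)) :=
    ⟨0, (Module.finrank_pos_iff_exists_ne_zero (R := 𝕜) (M := X)).2 ⟨x, hx⟩⟩
  let e := hsymm.eigenvectorBasis rfl
  let μ := hsymm.eigenvalues rfl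
  obtain ⟨i, -, hi⟩ := Finset.exists_min_image Finset.univ (fun i => ‖γ - (μ i : 𝕜)‖)
    Finset.univ_nonempty
  refine ⟨μ i, (hsymm.hasEigenvalue_eigenvalues rfl i).mem_spectrum, ?_⟩
  have hcoord : ∀ l, ⟪e l, T x - γ • x⟫_𝕜 = ((μ l : 𝕜) - γ) * ⟪e l, x⟫_𝕜 := fun l => by
    rw [inner_sub_right, inner_smul_right, sub_mul, ← hsymm, hsymm.apply_eigenvectorBasis rfl l,
      inner_smul_left, RCLike.conj_ofReal]
  calc ‖γ - (μ i : 𝕜)‖ ^ 2 * RCLike.re (a x x)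
      = ‖γ - (μ i : 𝕜)‖ ^ 2 * ‖x‖ ^ 2 := by rw [← inner_self_eq_norm_sq (𝕜 := 𝕜) x]; rfl
    _ = ∑ l, ‖γ - (μ i : 𝕜)‖ ^ 2 * ‖⟪e l, x⟫_𝕜‖ ^ 2 := by
        rw [← e.sum_sq_norm_inner_right x, Finset.mul_sum]
    _ ≤ ∑ l, ‖⟪e l, T x - γ • x⟫_𝕜‖ ^ 2 := by
        gcongr with l
        rw [hcoord, norm_mul, mul_pow, norm_sub_rev _ γ]
        gcongr
        exact hi l (Finset.mem_univ l)
    _ = ‖T x - γ • x‖ ^ 2 := e.sum_sq_norm_inner_right _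
    _ = RCLike.re (a (T x - γ • x) (T x - γ • x)) := by
        rw [← inner_self_eq_norm_sq (𝕜 := 𝕜)]; rfl

end IsPosDefHermitian

end PosDefHermitian

section Hilbert

variable {𝕜 E : Type*} [RCLike 𝕜] [NormedAddCommGroup E] [InnerProductSpace 𝕜 E]
variable {A B K : E →L[𝕜] E} {c : ℝ}

theorem mul_norm_le_norm_of_coercive (hA : ∀ x, c * ‖x‖ ^ 2 ≤ RCLike.re ⟪x, A x⟫_𝕜) (x : E) :
    c * ‖x‖ ≤ ‖A x‖ := by
  rcases (norm_nonneg x).eq_or_lt with h | h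
  · simp [← h]
  · have : c * ‖x‖ ^ 2 ≤ ‖x‖ * ‖A x‖ :=
      (hA x).trans ((RCLike.re_le_norm _).trans (norm_inner_le_norm _ _))
    nlinarith

variable [CompleteSpace E]

theorem isUnit_of_coercive (hc : 0 < c) (hA : ∀ x, c * ‖x‖ ^ 2 ≤ RCLike.re ⟪x, A x⟫_𝕜) :
    IsUnit A :=
  ContinuousLinearMap.isUnit_of_forall_le_norm_inner_map A (c := ⟨c, hc.le⟩) hc fun x =>
    calc ‖x‖ ^ 2 * c = c * ‖x‖ ^ 2 := mul_comm _ _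
      _ ≤ ‖⟪x, A x⟫_𝕜‖ := (hA x).trans (RCLike.re_le_norm _)
      _ = ‖⟪A x, x⟫_𝕜‖ := norm_inner_symm _ _

theorem isUnit_of_isSymmetric_of_bounded_below (hA : A.IsSymmetric) (hc : 0 < c)
    (h : ∀ x, c * ‖x‖ ≤ ‖A x‖) : IsUnit A := by
  have hanti : AntilipschitzWith (Real.toNNReal c⁻¹) A := by
    refine AddMonoidHomClass.antilipschitz_of_bound A fun x => ?_
    rw [Real.coe_toNNReal _ (inv_nonneg.2 hc.le), le_inv_mul_iff₀ hc]
    exact h x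
  rw [ContinuousLinearMap.isUnit_iff_bijective,
    ContinuousLinearMap.bijective_iff_dense_range_and_antilipschitz]
  refine ⟨?_, _, hanti⟩
  rw [Submodule.topologicalClosure_eq_top_iff]
  exact hA.orthogonal_range.trans (LinearMap.ker_eq_bot.2 hanti.injective)

theorem isUnit_smul_sub_of_im_ne_zero (hA : A.IsSymmetric) (hB : B.IsSymmetric) (hc : 0 < c)
    (hcoer : ∀ x, c * ‖x‖ ^ 2 ≤ RCLike.re ⟪x, A x⟫_𝕜) {γ : 𝕜} (hγ : RCLike.im γ ≠ 0) :
    IsUnit (γ • A - B) := by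
  have hpos : 0 < |RCLike.im γ| * c := mul_pos (abs_pos.2 hγ) hc
  refine ContinuousLinearMap.isUnit_of_forall_le_norm_inner_map _ (c := ⟨_, hpos.le⟩) hpos
    fun x => ?_
  have hAx : RCLike.im ⟪x, A x⟫_𝕜 = 0 := hA.im_inner_self_apply x
  have hBx : RCLike.im ⟪x, B x⟫_𝕜 = 0 := hB.im_inner_self_apply x
  have him : RCLike.im ⟪x, (γ • A - B) x⟫_𝕜 = RCLike.im γ * RCLike.re ⟪x, A x⟫_𝕜 := by
    simp [inner_sub_right, inner_smul_right, hAx, hBx]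
  calc ‖x‖ ^ 2 * (|RCLike.im γ| * c) = |RCLike.im γ| * (c * ‖x‖ ^ 2) := by ring
    _ ≤ |RCLike.im γ| * |RCLike.re ⟪x, A x⟫_𝕜| := by
        gcongr; exact (hcoer x).trans (le_abs_self _)
    _ = |RCLike.im ⟪x, (γ • A - B) x⟫_𝕜| := by rw [him, abs_mul]
    _ ≤ ‖⟪x, (γ • A - B) x⟫_𝕜‖ := RCLike.abs_im_le_norm _
    _ = ‖⟪(γ • A - B) x, x⟫_𝕜‖ := norm_inner_symm _ _

theorem isUnit_smul_sub_of_bounded_below (hA : A.IsSymmetric) (hB : B.IsSymmetric) (hc : 0 < c)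
    (hcoer : ∀ x, c * ‖x‖ ^ 2 ≤ RCLike.re ⟪x, A x⟫_𝕜) {γ : 𝕜} {δ : ℝ} (hδ : 0 < δ)
    (h : ∀ x, δ * ‖x‖ ≤ ‖(γ • A - B) x‖) : IsUnit (γ • A - B) := by
  by_cases hγ : RCLike.im γ = 0
  · refine isUnit_of_isSymmetric_of_bounded_below ?_ hδ h
    exact (hA.smul (RCLike.conj_eq_iff_im.2 hγ)).sub hB
  · exact isUnit_smul_sub_of_im_ne_zero hA hB hc hcoer hγ

/-- The operator `K` is symmetric only for the inner product defined by `A`; multiplying `γ - K` by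
`A` turns it into the pencil `γ • A - B`, whose two coefficients are symmetric. -/
theorem exists_approx_eigenvector_of_mem_spectrum (hA : A.IsSymmetric) (hB : B.IsSymmetric)
    (hc : 0 < c) (hcoer : ∀ x, c * ‖x‖ ^ 2 ≤ RCLike.re ⟪x, A x⟫_𝕜) (hK : A * K = B) {D : Set E}
    (hD : Dense D) {γ : 𝕜} (hγ : γ ∈ spectrum 𝕜 K) {ε : ℝ} (hε : 0 < ε) :
    ∃ φ ∈ D, ‖K φ - γ • φ‖ < ε * ‖φ‖ := by
  by_contra! h
  have hclosed : IsClosed {x | ε * ‖x‖ ≤ ‖K x - γ • x‖} :=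
    isClosed_le (by fun_prop) (by fun_prop)
  have hbelow : ∀ x, ε * ‖x‖ ≤ ‖K x - γ • x‖ := fun x => hclosed.closure_subset_iff.2 h (hD x)
  have hmul : A * (algebraMap 𝕜 (E →L[𝕜] E) γ - K) = γ • A - B := by
    rw [mul_sub, hK, Algebra.algebraMap_eq_smul_one, mul_smul_comm, mul_one]
  have hpencil : ∀ x, c * ε * ‖x‖ ≤ ‖(γ • A - B) x‖ := fun x => by
    have hx : (γ • A - B) x = A (γ • x - K x) := by rw [← hmul]; rfl
    calc c * ε * ‖x‖ = c * (ε * ‖x‖) := mul_assoc _ _ _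
      _ ≤ c * ‖γ • x - K x‖ := by gcongr; rw [norm_sub_rev]; exact hbelow x
      _ ≤ ‖A (γ • x - K x)‖ := mul_norm_le_norm_of_coercive hcoer _
      _ = ‖(γ • A - B) x‖ := by rw [hx]
  obtain ⟨u, hu⟩ := isUnit_of_coercive hc hcoer
  refine hγ ?_
  rw [spectrum.mem_resolventSet_iff, ← u.isUnit_units_mul, hu, hmul]
  exact isUnit_smul_sub_of_bounded_below hA hB hc hcoer (mul_pos hc hε) hpencil

end Hilbert

/-! ### Galerkin schemes with perturbed forms -/

section Galerkin

variable {𝕜 E : Type*} [RCLike 𝕜] [NormedAddCommGroup E] [InnerProductSpace 𝕜 E]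

/-- A Hermitian form on a space `X` mapped into `E` by `ι` whose quadratic form lies between `c` and
`M` times that of `E`. -/
structure IsEllipticForm {X : Type*} [AddCommGroup X] [Module 𝕜 X] (ι : X →ₗ[𝕜] E)
    (a : X →ₗ⋆[𝕜] X →ₗ[𝕜] 𝕜) (c M : ℝ) : Prop where
  isSymm : a.IsSymm
  lower : ∀ x, c * ‖ι x‖ ^ 2 ≤ RCLike.re (a x x)
  upper : ∀ x, RCLike.re (a x x) ≤ M * ‖ι x‖ ^ 2

theorem IsEllipticForm.isPosDefHermitian {X : Type*} [AddCommGroup X] [Module 𝕜 X]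
    {ι : X →ₗ[𝕜] E} {a : X →ₗ⋆[𝕜] X →ₗ[𝕜] 𝕜} {c M : ℝ} (ha : IsEllipticForm ι a c M) (hc : 0 < c)
    (hι : Function.Injective ι) : IsPosDefHermitian a where
  isSymm := ha.isSymm
  re_pos x hx := by
    have : 0 < ‖ι x‖ := norm_pos_iff.2 ((map_ne_zero_iff ι hι).2 hx)
    exact lt_of_lt_of_le (by positivity) (ha.lower x)

variable {I : Type*} {X : I → Type*} [∀ i, AddCommGroup (X i)] [∀ i, Module 𝕜 (X i)]
  {l : Filter I} {A B K : E →L[𝕜] E} {ι : ∀ i, X i →ₗ[𝕜] E} {a : ∀ i, X i →ₗ⋆[𝕜] X i →ₗ[𝕜] 𝕜}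
  {T : ∀ i, Module.End 𝕜 (X i)} {D : Set E} {c M : ℝ}

/-- A Galerkin scheme with perturbed forms (variational crimes) for the operator `A`: the forms
`a i` on the trial spaces `X i` are uniformly elliptic, and every element of the dense set `D`
eventually lies in the trial space, where the consistency error of `a i` tends to zero uniformly in
the other argument. -/
structure IsGalerkinScheme (l : Filter I) (A : E →L[𝕜] E) (ι : ∀ i, X i →ₗ[𝕜] E)
    (a : ∀ i, X i →ₗ⋆[𝕜] X i →ₗ[𝕜] 𝕜) (D : Set E) (c M : ℝ) : Prop where
  pos : 0 < c
  elliptic : ∀ᶠ i in l, IsEllipticForm (ι i) (a i) c M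
  injective : ∀ᶠ i in l, Function.Injective (ι i)
  dense : Dense D
  consistent : ∀ φ ∈ D, ∀ δ > 0, ∀ᶠ i in l,
    ∃ x, ι i x = φ ∧ ∀ w, ‖⟪ι i w, A φ⟫_𝕜 - a i w x‖ ≤ δ * ‖ι i w‖

/-- The operators `T i` solve the discrete problems `a i w (T i x) = ⟪w, B x⟫`. -/
def IsGalerkinSolution (l : Filter I) (B : E →L[𝕜] E) (ι : ∀ i, X i →ₗ[𝕜] E)
    (a : ∀ i, X i →ₗ⋆[𝕜] X i →ₗ[𝕜] 𝕜) (T : ∀ i, Module.End 𝕜 (X i)) : Prop :=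
  ∀ᶠ i in l, ∀ w x, a i w (T i x) = ⟪ι i w, B (ι i x)⟫_𝕜

namespace IsGalerkinScheme

theorem coercive [l.NeBot] (h : IsGalerkinScheme l A ι a D c M) (u : E) :
    c * ‖u‖ ^ 2 ≤ RCLike.re ⟪u, A u⟫_𝕜 := by
  have hclosed : IsClosed {u | c * ‖u‖ ^ 2 ≤ RCLike.re ⟪u, A u⟫_𝕜} :=
    isClosed_le (by fun_prop) (by fun_prop)
  refine hclosed.closure_subset_iff.2 (fun φ hφ => ?_) (h.dense u)
  change c * ‖φ‖ ^ 2 ≤ RCLike.re ⟪φ, A φ⟫_𝕜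
  refine le_of_forall_pos_le_add fun δ hδ => ?_
  obtain ⟨i, ⟨x, rfl, hx⟩, hi⟩ := ((h.consistent φ hφ (δ / (‖φ‖ + 1)) (by positivity)).and
    h.elliptic).exists
  have herr : RCLike.re (a i x x) - RCLike.re ⟪ι i x, A (ι i x)⟫_𝕜 ≤ δ :=
    calc RCLike.re (a i x x) - RCLike.re ⟪ι i x, A (ι i x)⟫_𝕜
        = RCLike.re (a i x x - ⟪ι i x, A (ι i x)⟫_𝕜) := (map_sub _ _ _).symm
      _ ≤ ‖⟪ι i x, A (ι i x)⟫_𝕜 - a i x x‖ := (RCLike.re_le_norm _).trans_eq (norm_sub_rev _ _)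
      _ ≤ δ / (‖ι i x‖ + 1) * ‖ι i x‖ := hx x
      _ ≤ δ / (‖ι i x‖ + 1) * (‖ι i x‖ + 1) := by gcongr; linarith
      _ = δ := div_mul_cancel₀ _ (by positivity)
  have := hi.lower x
  linarith

theorem isSymmetric [l.NeBot] (h : IsGalerkinScheme l A ι a D c M) : A.IsSymmetric := by
  suffices hD : ∀ φ ∈ D, ∀ ψ ∈ D, ⟪A φ, ψ⟫_𝕜 = ⟪φ, A ψ⟫_𝕜 by
    intro u v
    refine h.dense.induction (P := fun u => ⟪A u, v⟫_𝕜 = ⟪u, A v⟫_𝕜) (fun φ hφ => ?_)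
      (isClosed_eq (by fun_prop) (by fun_prop)) u
    exact h.dense.induction (P := fun v => ⟪A φ, v⟫_𝕜 = ⟪φ, A v⟫_𝕜) (hD φ hφ)
      (isClosed_eq (by fun_prop) (by fun_prop)) v
  intro φ hφ ψ hψ
  refine eq_of_forall_dist_le fun δ hδ => ?_
  have hη : 0 < δ / (‖φ‖ + ‖ψ‖ + 1) := by positivity
  obtain ⟨i, ⟨⟨x, rfl, hx⟩, y, rfl, hy⟩, hi⟩ := (((h.consistent φ hφ _ hη).and
    (h.consistent ψ hψ _ hη)).and h.elliptic).exists
  set η := δ / (‖ι i x‖ + ‖ι i y‖ + 1)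
  calc dist ⟪A (ι i x), ι i y⟫_𝕜 ⟪ι i x, A (ι i y)⟫_𝕜
      ≤ dist ⟪A (ι i x), ι i y⟫_𝕜 (a i x y) + dist ⟪ι i x, A (ι i y)⟫_𝕜 (a i x y) :=
        dist_triangle_right _ _ _
    _ = ‖⟪ι i y, A (ι i x)⟫_𝕜 - a i y x‖ + ‖⟪ι i x, A (ι i y)⟫_𝕜 - a i x y‖ := by
        rw [dist_eq_norm, dist_eq_norm, ← inner_conj_symm, ← hi.isSymm.eq y x, ← map_sub,
          RCLike.norm_conj]
    _ ≤ η * ‖ι i y‖ + η * ‖ι i x‖ := add_le_add (hx y) (hy x)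
    _ ≤ η * (‖ι i x‖ + ‖ι i y‖ + 1) := by linarith
    _ = δ := div_mul_cancel₀ _ (by positivity)

/-- Strang's lemma: the error is controlled by the best approximation of `K φ` in the trial space
and by the consistency error there. -/
theorem eventually_norm_solution_sub_le (h : IsGalerkinScheme l A ι a D c M) (hK : A * K = B)
    (hT : IsGalerkinSolution l B ι a T) (φ : E) {ε : ℝ} (hε : 0 < ε) :
    ∀ᶠ i in l, ∀ x, ι i x = φ → ‖ι i (T i x) - K φ‖ ≤ ε := by
  have hc := h.pos
  set δ := ε / ((‖A‖ + 1) / c + 1)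
  have hδ : 0 < δ := by positivity
  obtain ⟨v, hvD, hv⟩ := h.dense.exists_dist_lt (K φ) hδ
  rw [dist_eq_norm] at hv
  filter_upwards [h.consistent v hvD δ hδ, h.elliptic, hT]
  rintro i ⟨y, rfl, hy⟩ hi hTi x rfl
  set w := T i x - y
  have hAK : A (K (ι i x)) = B (ι i x) := by rw [← hK]; rfl
  have hww : a i w w = ⟪ι i w, A (K (ι i x) - ι i y)⟫_𝕜 + (⟪ι i w, A (ι i y)⟫_𝕜 - a i w y) := by
    rw [map_sub (a i w), hTi, map_sub A, inner_sub_right, hAK]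
    ring
  have hsq : c * ‖ι i w‖ ^ 2 ≤ (‖A‖ + 1) * δ * ‖ι i w‖ :=
    calc c * ‖ι i w‖ ^ 2 ≤ ‖a i w w‖ := (hi.lower w).trans (RCLike.re_le_norm _)
      _ ≤ ‖⟪ι i w, A (K (ι i x) - ι i y)⟫_𝕜‖ + ‖⟪ι i w, A (ι i y)⟫_𝕜 - a i w y‖ := by
          rw [hww]; exact norm_add_le _ _
      _ ≤ ‖ι i w‖ * (‖A‖ * δ) + δ * ‖ι i w‖ := by
          refine add_le_add ((norm_inner_le_norm _ _).trans ?_) (hy w)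
          gcongr
          exact A.le_of_opNorm_le_of_le le_rfl hv.le
      _ = (‖A‖ + 1) * δ * ‖ι i w‖ := by ring
  have hw : ‖ι i w‖ ≤ (‖A‖ + 1) / c * δ := by
    rw [div_mul_eq_mul_div, le_div_iff₀ hc]
    rcases (norm_nonneg (ι i w)).eq_or_lt with h0 | h0
    · rw [← h0, zero_mul]
      positivity
    · nlinarith
  calc ‖ι i (T i x) - K (ι i x)‖ = ‖ι i w - (K (ι i x) - ι i y)‖ := by
        rw [map_sub]; congr 1; abel
    _ ≤ (‖A‖ + 1) / c * δ + δ := (norm_sub_le _ _).trans (add_le_add hw hv.le)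
    _ = ((‖A‖ + 1) / c + 1) * δ := by ring
    _ = ε := mul_div_cancel₀ _ (by positivity)

variable [∀ i, FiniteDimensional 𝕜 (X i)]

theorem eventually_exists_mem_spectrum_near (h : IsGalerkinScheme l A ι a D c M)
    (hB : B.IsSymmetric) (hT : IsGalerkinSolution l B ι a T) (γ : 𝕜) :
    ∀ᶠ i in l, ∀ x, ι i x ≠ 0 → ∃ μ ∈ spectrum 𝕜 (T i),
      c * (‖γ - μ‖ * ‖ι i x‖) ^ 2 ≤ M * ‖ι i (T i x) - γ • ι i x‖ ^ 2 := by
  filter_upwards [h.elliptic, h.injective, hT] with i hi hιi hTi x hx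
  have hsymm : ∀ x y, a i (T i x) y = a i x (T i y) := fun x y => by
    rw [← hi.isSymm.eq y, hTi, hTi, inner_conj_symm]
    exact hB _ _
  obtain ⟨μ, hμ, hle⟩ := (hi.isPosDefHermitian h.pos hιi).exists_mem_spectrum_near hsymm γ
    (x := x) (by rintro rfl; exact hx (map_zero _))
  refine ⟨μ, hμ, ?_⟩
  calc c * (‖γ - μ‖ * ‖ι i x‖) ^ 2 = ‖γ - μ‖ ^ 2 * (c * ‖ι i x‖ ^ 2) := by ring
    _ ≤ ‖γ - μ‖ ^ 2 * RCLike.re (a i x x) := by gcongr; exact hi.lower x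
    _ ≤ M * ‖ι i (T i x - γ • x)‖ ^ 2 := hle.trans (hi.upper _)
    _ = M * ‖ι i (T i x) - γ • ι i x‖ ^ 2 := by rw [map_sub, map_smul]

variable [CompleteSpace E]

/-- An approximate eigenvector of `K` in `D` is eventually one of `T i`, by Strang's lemma. -/
theorem eventually_exists_mem_spectrum_dist_le [l.NeBot] (h : IsGalerkinScheme l A ι a D c M)
    (hB : B.IsSymmetric) (hK : A * K = B) (hT : IsGalerkinSolution l B ι a T) {γ : 𝕜}
    (hγ : γ ∈ spectrum 𝕜 K) {r : ℝ} (hr : 0 < r) :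
    ∀ᶠ i in l, ∃ μ ∈ spectrum 𝕜 (T i), dist γ μ ≤ r := by
  have hc := h.pos
  set η := r * √(c / (|M| + 1)) / 2
  have hη : 0 < η := by positivity
  have hη_sq : |M| * (2 * η) ^ 2 ≤ c * r ^ 2 :=
    calc |M| * (2 * η) ^ 2 = |M| * (r ^ 2 * (c / (|M| + 1))) := by
          rw [mul_div_cancel₀ _ two_ne_zero, mul_pow, Real.sq_sqrt (by positivity)]
      _ ≤ (|M| + 1) * (r ^ 2 * (c / (|M| + 1))) := by gcongr; linarith
      _ = c * r ^ 2 := by field_simp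
  obtain ⟨φ, hφD, hφ⟩ := exists_approx_eigenvector_of_mem_spectrum h.isSymmetric hB hc h.coercive
    hK h.dense hγ hη
  have hφ_pos : 0 < ‖φ‖ := pos_of_mul_pos_right ((norm_nonneg _).trans_lt hφ) hη.le
  filter_upwards [h.eventually_norm_solution_sub_le hK hT φ (mul_pos hη hφ_pos),
    h.consistent φ hφD 1 one_pos, h.eventually_exists_mem_spectrum_near hB hT γ]
  rintro i hconv ⟨x, rfl, -⟩ hspec
  obtain ⟨μ, hμ, hle⟩ := hspec x (norm_pos_iff.1 hφ_pos)
  have hres : ‖ι i (T i x) - γ • ι i x‖ ≤ 2 * η * ‖ι i x‖ := by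
    have := norm_sub_le_norm_sub_add_norm_sub (ι i (T i x)) (K (ι i x)) (γ • ι i x)
    linarith [hconv x rfl]
  refine ⟨μ, hμ, ?_⟩
  have hsq : c * (dist γ μ * ‖ι i x‖) ^ 2 ≤ c * (r * ‖ι i x‖) ^ 2 :=
    calc c * (dist γ μ * ‖ι i x‖) ^ 2 ≤ M * ‖ι i (T i x) - γ • ι i x‖ ^ 2 := by
          rwa [dist_eq_norm]
      _ ≤ |M| * (2 * η * ‖ι i x‖) ^ 2 := by gcongr; exact le_abs_self M
      _ = |M| * (2 * η) ^ 2 * ‖ι i x‖ ^ 2 := by ring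
      _ ≤ c * r ^ 2 * ‖ι i x‖ ^ 2 := by gcongr
      _ = c * (r * ‖ι i x‖) ^ 2 := by ring
  exact le_of_mul_le_mul_right
    (le_of_sq_le_sq (le_of_mul_le_mul_left hsq hc) (by positivity)) hφ_pos

theorem tendsto_infEDist_spectrum [l.NeBot] (h : IsGalerkinScheme l A ι a D c M)
    (hB : B.IsSymmetric) (hK : A * K = B) (hT : IsGalerkinSolution l B ι a T) {γ : 𝕜}
    (hγ : γ ∈ spectrum 𝕜 K) :
    Tendsto (fun i => Metric.infEDist γ (spectrum 𝕜 (T i))) l (𝓝 0) := by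
  refine ENNReal.tendsto_nhds_zero.2 fun ρ hρ => ?_
  obtain ⟨r, hr, hrρ⟩ := ENNReal.lt_iff_exists_nnreal_btwn.1 hρ
  filter_upwards [h.eventually_exists_mem_spectrum_dist_le hB hK hT hγ (r := r) (by simpa using hr)]
  rintro i ⟨μ, hμ, hle⟩
  calc Metric.infEDist γ (spectrum 𝕜 (T i)) ≤ edist γ μ := Metric.infEDist_le_edist_of_mem hμ
    _ ≤ r := by rw [edist_nndist]; exact_mod_cast hle
    _ ≤ ρ := hrρ.le

end IsGalerkinScheme

end Galerkin

/-! ### Characters of the torus -/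

section Character

variable {n : ℕ}

theorem character_apply (k : Fin n → ℤ) (y : Torus n) :
    character k y = ∏ i, fourier (k i) (y i) := rfl

theorem character_zero : character (0 : Fin n → ℤ) = 1 := by
  ext y
  simp [character_apply]

theorem character_add (k l : Fin n → ℤ) : character (k + l) = character k * character l := by
  ext y
  simp [character_apply, Finset.prod_mul_distrib]

theorem character_neg_apply (k : Fin n → ℤ) (y : Torus n) :
    character (-k) y = conj (character k y) := by
  simp [character_apply]

theorem character_apply_add (k : Fin n → ℤ) (y z : Torus n) :
    character k (y + z) = character k y * character k z := by
  simp [character_apply, Finset.prod_mul_distrib, AddCircle.toCircle_add]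

theorem character_toTorus (k : Fin n → ℤ) (x : Fin n → ℝ) :
    character k (toTorus x) = Complex.exp (Complex.I * ((∑ i, (k i : ℝ) * x i : ℝ) : ℂ)) := by
  have hπ : (π : ℂ) ≠ 0 := by exact_mod_cast Real.pi_ne_zero
  simp only [character_apply, toTorus, fourier_coe_apply]
  rw [← Complex.exp_sum]
  congr 1
  push_cast
  rw [Finset.mul_sum]
  refine Finset.sum_congr rfl fun i _ => ?_
  field_simp

/-- Rescaling each coordinate reduces the claim to the torus `(ℝ / ℤ)ⁿ`. -/
theorem span_character_closure_eq_top (n : ℕ) :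
    (Submodule.span ℂ (Set.range (character (n := n)))).topologicalClosure = ⊤ := by
  let e : Torus n ≃ₜ UnitAddTorus (Fin n) := Homeomorph.piCongrRight fun _ =>
    AddCircle.homeomorphAddCircle (2 * π) 1 Real.two_pi_pos.ne' one_ne_zero
  let Φ : C(UnitAddTorus (Fin n), ℂ) →L[ℂ] C(Torus n, ℂ) :=
    { (ContinuousMap.compRightAlgHom ℂ ℂ (e : C(Torus n, UnitAddTorus (Fin n)))).toLinearMap with
      cont := ContinuousMap.compRightAlgHom_continuous _ _ _ }
  have hΦ : Function.Surjective Φ := fun f =>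
    ⟨f.comp (e.symm : C(UnitAddTorus (Fin n), Torus n)),
      ContinuousMap.ext fun y => congrArg f (e.symm_apply_apply y)⟩
  have hchar : ∀ k, Φ (UnitAddTorus.mFourier k) = character k := fun k => by
    refine ContinuousMap.ext fun y => ?_
    change ∏ i, fourier (k i) (AddCircle.homeomorphAddCircle (2 * π) 1 _ _ (y i)) =
      ∏ i, fourier (k i) (y i)
    refine Finset.prod_congr rfl fun i _ => ?_
    induction y i using QuotientAddGroup.induction_on with
    | H t =>
      rw [AddCircle.homeomorphAddCircle_apply_mk, fourier_coe_apply, fourier_coe_apply]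
      push_cast
      congr 1
      ring
  simpa only [Submodule.map_span, ContinuousLinearMap.coe_coe, ← Set.range_comp,
    Function.comp_def, hchar] using hΦ.denseRange.topologicalClosure_map_submodule
      UnitAddTorus.span_mFourier_closure_eq_top

theorem integral_character (k : Fin n → ℤ) :
    ∫ y, character k y ∂(torusMeasure n) = if k = 0 then 1 else 0 := by
  split_ifs with h
  · subst h
    simp [character_zero]
  · obtain ⟨i, hi⟩ := Function.ne_iff.1 h
    simp only [character_apply]
    rw [integral_fintype_prod_eq_prod (𝕜 := ℂ)]
    refine Finset.prod_eq_zero (Finset.mem_univ i) ?_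
    exact integral_eq_zero_of_add_right_eq_neg
      (μ := AddCircle.haarAddCircle (T := 2 * π)) (fourier_add_half_inv_index hi Real.two_pi_pos)

theorem measure_eq_of_integral_character_eq {μ ν : Measure (Torus n)} [IsFiniteMeasure μ]
    [IsFiniteMeasure ν] (h : ∀ k, ∫ y, character k y ∂μ = ∫ y, character k y ∂ν) : μ = ν := by
  let I (ρ : Measure (Torus n)) [IsFiniteMeasure ρ] : C(Torus n, ℂ) →L[ℂ] ℂ :=
    innerSL ℂ (ContinuousMap.toLp 2 ρ ℂ 1) ∘L ContinuousMap.toLp 2 ρ ℂ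
  have hI : ∀ (ρ : Measure (Torus n)) [IsFiniteMeasure ρ] f, I ρ f = ∫ y, f y ∂ρ :=
    fun ρ _ f => (ContinuousMap.inner_toLp ρ 1 f).trans (by simp)
  have hIμν : I μ = I ν := by
    refine ContinuousLinearMap.ext_on
      ((Submodule.dense_iff_topologicalClosure_eq_top).2 (span_character_closure_eq_top n)) ?_
    rintro _ ⟨k, rfl⟩
    rw [hI, hI, h]
  refine ext_of_forall_integral_eq_of_IsFiniteMeasure fun f => ?_
  let g : C(Torus n, ℂ) := ⟨fun y => (f y : ℂ), by fun_prop⟩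
  have hg : ∀ (ρ : Measure (Torus n)) [IsFiniteMeasure ρ], I ρ g = ((∫ y, f y ∂ρ : ℝ) : ℂ) :=
    fun ρ _ => (hI ρ g).trans integral_complex_ofReal
  exact_mod_cast (hg μ).symm.trans ((DFunLike.congr_fun hIμν g).trans (hg ν))

theorem integral_character_eq_zero_of_ne_one {H : AddSubgroup (Torus n)} (ν : Measure H)
    [ν.IsAddRightInvariant] {k : Fin n → ℤ} {z : Torus n} (hz : z ∈ H) (hk : character k z ≠ 1) :
    ∫ y : H, character k y ∂ν = 0 := by
  have h : (∫ y : H, character k y ∂ν) * character k z = ∫ y : H, character k y ∂ν := by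
    simpa only [AddSubgroup.coe_add, character_apply_add, integral_mul_const] using
      integral_add_right_eq_self (μ := ν) (fun y : H => character k y) ⟨z, hz⟩
  exact by_contra fun hne => hk ((mul_eq_left₀ hne).1 h)

/-- The Haar probability measure of `H` has the same character integrals as that of the torus, so
the two agree and the open set `Hᶜ` has measure zero. -/
theorem eq_top_of_forall_exists_character_ne_one {H : AddSubgroup (Torus n)}
    (hclosed : IsClosed (H : Set (Torus n)))
    (h : ∀ k : Fin n → ℤ, k ≠ 0 → ∃ y ∈ H, character k y ≠ 1) : H = ⊤ := by
  have : CompactSpace H := isCompact_iff_compactSpace.1 hclosed.isCompact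
  let ν : Measure H := Measure.addHaarMeasure ⊤
  have : IsProbabilityMeasure ν := ⟨Measure.addHaarMeasure_self⟩
  have hμ : ν.map Subtype.val = torusMeasure n := by
    refine measure_eq_of_integral_character_eq fun k => ?_
    rw [integral_map measurable_subtype_coe.aemeasurable
      (character k).continuous.aestronglyMeasurable, integral_character]
    split_ifs with hk
    · simp [hk, character_zero]
    · obtain ⟨z, hz, hz1⟩ := h k hk
      exact integral_character_eq_zero_of_ne_one ν hz hz1
  have hnull : torusMeasure n (H : Set (Torus n))ᶜ = 0 := by
    rw [← hμ, Measure.map_apply measurable_subtype_coe hclosed.measurableSet.compl,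
      Set.preimage_compl, Subtype.coe_preimage_self, Set.compl_univ, measure_empty]
  exact SetLike.coe_injective
    (Set.compl_empty_iff.1 ((hclosed.isOpen_compl.measure_eq_zero_iff _).1 hnull))

variable {d : ℕ} (P : Matrix (Fin d) (Fin n) ℝ)

/-- The additive subgroup `{Pᵀx : x ∈ ℝᵈ}` of the torus, on which the parent function is sampled by
the quasiperiodic coefficient. -/
def orbit : AddSubgroup (Torus n) where
  carrier := Set.range fun x : Fin d → ℝ => (toTorus (Pᵀ *ᵥ x) : Torus n)
  zero_mem' := ⟨0, by ext; simp [toTorus]⟩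
  add_mem' := by
    rintro _ _ ⟨x, rfl⟩ ⟨z, rfl⟩
    exact ⟨x + z, by simp only [Matrix.mulVec_add, toTorus_add]⟩
  neg_mem' := by
    rintro _ ⟨x, rfl⟩
    exact ⟨-x, by ext; simp [toTorus, Matrix.mulVec_neg]⟩

variable {P}

theorem mulVec_intCast_ne_zero (hP : LinearIndependent ℚ fun i j => P j i) {k : Fin n → ℤ}
    (hk : k ≠ 0) : P *ᵥ (fun i => (k i : ℝ)) ≠ 0 := by
  contrapose! hk
  have := Fintype.linearIndependent_iff.1 hP (fun i => (k i : ℚ)) <| funext fun j => by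
    simpa [Matrix.mulVec, dotProduct, Rat.smul_def, mul_comm] using congrFun hk j
  exact funext fun i => by exact_mod_cast this i

theorem exists_character_ne_one (hP : LinearIndependent ℚ fun i j => P j i) {k : Fin n → ℤ}
    (hk : k ≠ 0) : ∃ x : Fin d → ℝ, character k (toTorus (Pᵀ *ᵥ x)) ≠ 1 := by
  let v := P *ᵥ (fun i => (k i : ℝ))
  have hv : v ⬝ᵥ v ≠ 0 := fun h => mulVec_intCast_ne_zero hP hk (dotProduct_self_eq_zero.1 h)
  refine ⟨(π / (v ⬝ᵥ v)) • v, ?_⟩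
  have hphase : (fun i => (k i : ℝ)) ⬝ᵥ (Pᵀ *ᵥ ((π / (v ⬝ᵥ v)) • v)) = π := by
    rw [dotProduct_mulVec, vecMul_transpose, dotProduct_smul, smul_eq_mul]
    exact div_mul_cancel₀ π hv
  rw [character_toTorus, show ∑ i, (k i : ℝ) * _ = π from hphase, mul_comm, Complex.exp_pi_mul_I]
  norm_num

theorem denseRange_toTorus_transpose_mulVec (hP : LinearIndependent ℚ fun i j => P j i) :
    DenseRange fun x : Fin d → ℝ => (toTorus (Pᵀ *ᵥ x) : Torus n) := by
  have htop : (orbit P).topologicalClosure = ⊤ :=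
    eq_top_of_forall_exists_character_ne_one (AddSubgroup.isClosed_topologicalClosure _)
      fun k hk =>
        let ⟨x, hx⟩ := exists_character_ne_one hP hk
        ⟨_, AddSubgroup.le_topologicalClosure _ ⟨x, rfl⟩, hx⟩
  exact dense_iff_closure_eq.2 (congrArg SetLike.coe htop)

theorem inner_toLp_character (k : Fin n → ℤ) (U : L2 n) :
    ⟪ContinuousMap.toLp 2 (torusMeasure n) ℂ (character k), U⟫_ℂ =
      ∫ y, U y * character (-k) y ∂(torusMeasure n) := by
  rw [L2.inner_def]
  refine integral_congr_ae ?_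
  filter_upwards [ContinuousMap.coeFn_toLp (p := 2) (𝕜 := ℂ) (torusMeasure n) (character k)]
    with y hy
  rw [hy, character_neg_apply, RCLike.inner_apply]

theorem eq_zero_of_integral_mul_character_eq_zero {U : L2 n}
    (h : ∀ k : Fin n → ℤ, ∫ y, U y * character k y ∂(torusMeasure n) = 0) : U = 0 := by
  let J : C(Torus n, ℂ) →L[ℂ] L2 n := ContinuousMap.toLp 2 (torusMeasure n) ℂ
  have hzero : innerSL ℂ U ∘L J = 0 := by
    refine ContinuousLinearMap.ext_on
      ((Submodule.dense_iff_topologicalClosure_eq_top).2 (span_character_closure_eq_top n)) ?_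
    rintro _ ⟨k, rfl⟩
    exact inner_eq_zero_symm.1 ((inner_toLp_character k U).trans (h (-k)))
  refine Dense.eq_zero_of_inner_left ℂ
    (ContinuousMap.toLp_denseRange ℂ (torusMeasure n) ℂ ENNReal.ofNat_ne_top) ?_
  rintro _ ⟨f, rfl⟩
  exact DFunLike.congr_fun hzero f

end Character

section DenseRange

variable {X ι m : Type*} [TopologicalSpace X] {f : ι → X} {M : X → Matrix m m ℝ}

theorem isSymm_of_denseRange (hf : DenseRange f) (hM : Continuous M)
    (h : ∀ i, (M (f i)).IsSymm) (x : X) : (M x).IsSymm :=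
  hf.induction_on (p := fun x => (M x).IsSymm) x (isClosed_eq hM.matrix_transpose hM) h

theorem mul_dotProduct_le_of_denseRange [Fintype m] (hf : DenseRange f) (hM : Continuous M) {c : ℝ}
    (h : ∀ i (ξ : m → ℝ), c * (ξ ⬝ᵥ ξ) ≤ ξ ⬝ᵥ (M (f i) *ᵥ ξ)) (x : X) (ξ : m → ℝ) :
    c * (ξ ⬝ᵥ ξ) ≤ ξ ⬝ᵥ (M x *ᵥ ξ) :=
  hf.induction_on (p := fun x => c * (ξ ⬝ᵥ ξ) ≤ ξ ⬝ᵥ (M x *ᵥ ξ)) x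
    (isClosed_le continuous_const
      (continuous_const.dotProduct (hM.matrix_mulVec continuous_const))) fun i => h i ξ

end DenseRange

/-! ### Test functions and `H¹_P` -/

section SobolevSpace

variable {d n : ℕ} (P : Matrix (Fin d) (Fin n) ℝ)

section TestFunction

variable {φ ψ : Torus n → ℂ}

theorem integrable_of_continuous {g : Torus n → ℂ} (hg : Continuous g) :
    Integrable g (torusMeasure n) :=
  hg.integrable_of_hasCompactSupport (HasCompactSupport.of_compactSpace g)

theorem IsTestFunction.add (hφ : IsTestFunction φ) (hψ : IsTestFunction ψ) :
    IsTestFunction (φ + ψ) :=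
  ContDiff.add hφ hψ

theorem IsTestFunction.mul (hφ : IsTestFunction φ) (hψ : IsTestFunction ψ) :
    IsTestFunction (φ * ψ) :=
  ContDiff.mul hφ hψ

theorem IsTestFunction.smul (c : ℂ) (hφ : IsTestFunction φ) : IsTestFunction (c • φ) :=
  ContDiff.const_smul c hφ

theorem toTorus_single_zero (i : Fin n) : toTorus (Pi.single i (0 : ℝ)) = (0 : Torus n) := by
  ext
  simp [toTorus]

theorem IsTestFunction.hasDerivAt (h : IsTestFunction φ) (i : Fin n) (y : Torus n) (t : ℝ) :
    HasDerivAt (fun t : ℝ => φ (y + toTorus (Pi.single i t)))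
      (partialDeriv φ i (y + toTorus (Pi.single i t))) t := by
  obtain ⟨x, rfl⟩ := (isOpenQuotientMap_toTorus n).surjective y
  have hφ : HasFDerivAt (fun x : Fin n → ℝ => φ (toTorus x)) _ (x + Pi.single i t) :=
    (ContDiff.differentiable h (by simp) _).hasFDerivAt
  have hline : HasDerivAt (fun t : ℝ => x + Pi.single i t) (Pi.single i 1) t :=
    (hasDerivAt_single i t).const_add x
  simp only [← toTorus_add, partialDeriv_toTorus h]
  exact hφ.comp_hasDerivAt t hline

theorem IsTestFunction.hasDerivAt_zero (h : IsTestFunction φ) (i : Fin n) (y : Torus n) :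
    HasDerivAt (fun t : ℝ => φ (y + toTorus (Pi.single i t))) (partialDeriv φ i y) 0 := by
  simpa only [toTorus_single_zero, add_zero] using h.hasDerivAt i y 0

theorem partialDeriv_add (hφ : IsTestFunction φ) (hψ : IsTestFunction ψ) (i : Fin n)
    (y : Torus n) : partialDeriv (φ + ψ) i y = partialDeriv φ i y + partialDeriv ψ i y :=
  ((hφ.hasDerivAt_zero i y).add (hψ.hasDerivAt_zero i y)).deriv

theorem partialDeriv_smul (c : ℂ) (hφ : IsTestFunction φ) (i : Fin n) (y : Torus n) :
    partialDeriv (c • φ) i y = c * partialDeriv φ i y :=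
  ((hφ.hasDerivAt_zero i y).const_smul c).deriv

theorem partialDeriv_mul (hφ : IsTestFunction φ) (hψ : IsTestFunction ψ) (i : Fin n)
    (y : Torus n) :
    partialDeriv (φ * ψ) i y = partialDeriv φ i y * ψ y + φ y * partialDeriv ψ i y := by
  have h := ((hφ.hasDerivAt_zero i y).mul (hψ.hasDerivAt_zero i y)).deriv
  rwa [toTorus_single_zero, add_zero] at h

theorem projGrad_add (hφ : IsTestFunction φ) (hψ : IsTestFunction ψ) (y : Torus n) :
    projGrad P (φ + ψ) y = projGrad P φ y + projGrad P ψ y := by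
  ext j
  simp only [projGrad, partialDeriv_add hφ hψ, mul_add, Finset.sum_add_distrib, Pi.add_apply]

theorem projGrad_smul (c : ℂ) (hφ : IsTestFunction φ) (y : Torus n) :
    projGrad P (c • φ) y = c • projGrad P φ y := by
  ext j
  simp only [projGrad, partialDeriv_smul c hφ, Pi.smul_apply, smul_eq_mul, Finset.mul_sum,
    mul_left_comm]

theorem projGrad_mul (hφ : IsTestFunction φ) (hψ : IsTestFunction ψ) (y : Torus n) (j : Fin d) :
    projGrad P (φ * ψ) y j = projGrad P φ y j * ψ y + φ y * projGrad P ψ y j := by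
  simp only [projGrad, partialDeriv_mul hφ hψ, Finset.sum_mul, Finset.mul_sum,
    ← Finset.sum_add_distrib]
  exact Finset.sum_congr rfl fun i _ => by ring

/-- Translating in the direction `i` does not change the integral of `φ`. -/
theorem IsTestFunction.integral_partialDeriv (h : IsTestFunction φ) (i : Fin n) :
    ∫ y, partialDeriv φ i y ∂(torusMeasure n) = 0 := by
  have hcont := h.continuous_partialDeriv i
  obtain ⟨C, hC⟩ := isCompact_univ.exists_bound_of_continuousOn hcont.continuousOn
  have hshift : ∀ t : ℝ, Continuous fun y : Torus n => y + toTorus (Pi.single i t) := fun t =>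
    continuous_id.add continuous_const
  have hderiv := (hasDerivAt_integral_of_dominated_loc_of_deriv_le (μ := torusMeasure n)
    (F := fun t y => φ (y + toTorus (Pi.single i t)))
    (F' := fun t y => partialDeriv φ i (y + toTorus (Pi.single i t))) (x₀ := (0 : ℝ))
    (bound := fun _ => C) (s := Set.univ) Filter.univ_mem
    (Eventually.of_forall fun t => (h.continuous.comp (hshift t)).aestronglyMeasurable)
    (integrable_of_continuous (h.continuous.comp (hshift 0)))
    (hcont.comp (hshift 0)).aestronglyMeasurable
    (ae_of_all _ fun y t _ => hC _ trivial) (integrable_const C)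
    (ae_of_all _ fun y t _ => h.hasDerivAt i y t)).2
  simp only [integral_add_right_eq_self, toTorus_single_zero, add_zero] at hderiv
  exact hderiv.unique (hasDerivAt_const 0 _)

theorem IsTestFunction.integral_projGrad (h : IsTestFunction φ) (j : Fin d) :
    ∫ y, projGrad P φ y j ∂(torusMeasure n) = 0 := by
  simp only [projGrad]
  rw [integral_finsetSum _ fun i _ =>
    (integrable_of_continuous (h.continuous_partialDeriv i)).const_mul _]
  simp only [integral_const_mul, h.integral_partialDeriv, mul_zero, Finset.sum_const_zero]

theorem integral_projGrad_mul (hφ : IsTestFunction φ) (hψ : IsTestFunction ψ) (j : Fin d) :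
    ∫ y, projGrad P φ y j * ψ y ∂(torusMeasure n) =
      -∫ y, φ y * projGrad P ψ y j ∂(torusMeasure n) := by
  have h := (hφ.mul hψ).integral_projGrad P j
  simp only [projGrad_mul P hφ hψ] at h
  rwa [integral_add (f := fun y => projGrad P φ y j * ψ y) (g := fun y => φ y * projGrad P ψ y j)
    (integrable_of_continuous ((hφ.continuous_projGrad P j).mul hψ.continuous))
    (integrable_of_continuous (hφ.continuous.mul (hψ.continuous_projGrad P j))),
    add_eq_zero_iff_eq_neg] at h

theorem isTestFunction_character (k : Fin n → ℤ) : IsTestFunction (character k) := by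
  unfold IsTestFunction
  simp only [character_toTorus]
  have h : ContDiff ℝ ∞ fun x : Fin n → ℝ => ∑ i, (k i : ℝ) * x i := by fun_prop
  exact Complex.contDiff_exp.comp (contDiff_const.mul (Complex.ofRealCLM.contDiff.comp h))

theorem character_add_single (k : Fin n → ℤ) (y : Torus n) (i : Fin n) (t : ℝ) :
    character k (y + toTorus (Pi.single i t)) =
      character k y * Complex.exp (Complex.I * ((k i : ℂ) * t)) := by
  have hsum : ∑ j, (k j : ℝ) * (Pi.single i t : Fin n → ℝ) j = k i * t := dotProduct_single _ _ _
  rw [character_apply_add, character_toTorus, hsum]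
  push_cast
  rfl

theorem partialDeriv_character (k : Fin n → ℤ) (i : Fin n) (y : Torus n) :
    partialDeriv (character k) i y = Complex.I * k i * character k y := by
  have hphase : HasDerivAt (fun t : ℝ => Complex.I * ((k i : ℂ) * (t : ℂ)))
      (Complex.I * ((k i : ℂ) * 1)) 0 :=
    ((Complex.ofRealCLM.hasDerivAt (x := (0 : ℝ))).const_mul (k i : ℂ)).const_mul Complex.I
  simp only [partialDeriv, character_add_single]
  rw [(hphase.cexp.const_mul (character k y)).deriv]
  simp only [Complex.ofReal_zero, mul_zero, Complex.exp_zero, one_mul, mul_one]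
  ring

/-- The Fourier symbol of `P∇` at the frequency `k`, namely the vector `i P k`. -/
def symbol (k : Fin n → ℤ) (j : Fin d) : ℂ := Complex.I * ∑ i, (P j i : ℂ) * k i

theorem symbol_neg (k : Fin n → ℤ) (j : Fin d) : symbol P (-k) j = -symbol P k j := by
  simp [symbol]

theorem projGrad_character (k : Fin n → ℤ) (y : Torus n) (j : Fin d) :
    projGrad P (character k) y j = symbol P k j * character k y := by
  simp only [projGrad, partialDeriv_character, symbol, Finset.mul_sum, Finset.sum_mul]
  exact Finset.sum_congr rfl fun i _ => by ring

end TestFunction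

section Embedding

/-- The space of smooth functions on the torus. -/
def testSpace (n : ℕ) : Submodule ℂ C(Torus n, ℂ) where
  carrier := {f | IsTestFunction f}
  zero_mem' := (contDiff_const : ContDiff ℝ ∞ fun _ : Fin n → ℝ => (0 : ℂ))
  add_mem' := IsTestFunction.add
  smul_mem' c _ := IsTestFunction.smul c

/-- The `j`-th component of the classical `P∇` as a linear map into the continuous functions. -/
def testGrad (j : Fin d) : testSpace n →ₗ[ℂ] C(Torus n, ℂ) where
  toFun φ := ⟨fun y => projGrad P φ y j, IsTestFunction.continuous_projGrad P φ.2 j⟩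
  map_add' φ ψ := ContinuousMap.ext fun y => congrFun (projGrad_add P φ.2 ψ.2 y) j
  map_smul' c φ := ContinuousMap.ext fun y => congrFun (projGrad_smul P c φ.2 y) j

/-- The inclusion of the continuous functions into `L²`. -/
abbrev contToL2 (n : ℕ) : C(Torus n, ℂ) →L[ℂ] L2 n :=
  ContinuousMap.toLp 2 (torusMeasure n) ℂ

theorem coeFn_contToL2 (f : C(Torus n, ℂ)) : contToL2 n f =ᵐ[torusMeasure n] f :=
  ContinuousMap.coeFn_toLp (p := 2) (𝕜 := ℂ) (torusMeasure n) f

theorem integral_contToL2_mul (f : C(Torus n, ℂ)) (g : Torus n → ℂ) :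
    ∫ y, contToL2 n f y * g y ∂(torusMeasure n) = ∫ y, f y * g y ∂(torusMeasure n) :=
  integral_congr_ae ((coeFn_contToL2 f).mul (EventuallyEq.refl _ g))

theorem inner_contToL2 (f g : C(Torus n, ℂ)) : ⟪contToL2 n g, contToL2 n f⟫_ℂ = innerL2 f g :=
  ContinuousMap.inner_toLp _ g f

theorem isWeakProjGrad_contToL2 (φ : testSpace n) :
    IsWeakProjGrad P (contToL2 n φ) fun j => contToL2 n (testGrad P j φ) := fun ψ hψ j => by
  rw [integral_contToL2_mul, integral_contToL2_mul]
  exact integral_projGrad_mul P φ.2 hψ j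

/-- The embedding `φ ↦ (φ, P∇φ)` of the smooth functions into `H¹_P`. -/
def embed : testSpace n →ₗ[ℂ] H1P P where
  toFun φ := ⟨WithLp.toLp 2 (contToL2 n φ, WithLp.toLp 2 fun j => contToL2 n (testGrad P j φ)),
    isWeakProjGrad_contToL2 P φ⟩
  map_add' _ _ := Subtype.ext <| WithLp.ofLp_injective 2 <| Prod.ext (map_add (contToL2 n) _ _) <|
    WithLp.ofLp_injective 2 <| funext fun j =>
      ((contToL2 n).toLinearMap ∘ₗ testGrad P j).map_add _ _
  map_smul' _ _ := Subtype.ext <| WithLp.ofLp_injective 2 <|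
    Prod.ext (map_smul (contToL2 n) _ _) <| WithLp.ofLp_injective 2 <| funext fun j =>
      ((contToL2 n).toLinearMap ∘ₗ testGrad P j).map_smul _ _

theorem toL2_embed (φ : testSpace n) : toL2 (embed P φ) = contToL2 n φ := rfl

theorem weakGrad_embed (φ : testSpace n) (j : Fin d) :
    weakGrad (embed P φ) j = contToL2 n (testGrad P j φ) := rfl

theorem embed_injective : Function.Injective (embed (n := n) P) := fun _ _ h =>
  Subtype.ext <| ContinuousMap.toLp_injective (torusMeasure n) (congrArg toL2 h)

end Embedding

section HilbertSpace

theorem integral_mul_eq_inner (U : L2 n) (g : C(Torus n, ℂ)) :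
    ∫ y, U y * g y ∂(torusMeasure n) = ⟪contToL2 n (star g), U⟫_ℂ := by
  rw [L2.inner_def]
  refine integral_congr_ae ?_
  filter_upwards [coeFn_contToL2 (star g)] with y hy
  rw [hy, RCLike.inner_apply, ContinuousMap.star_apply, RCLike.star_def, RCLike.conj_conj]

theorem isClosed_H1P : IsClosed (H1P P : Set (WithLp 2 (L2 n × PiLp 2 fun _ : Fin d => L2 n))) := by
  have h : (H1P P : Set (WithLp 2 (L2 n × PiLp 2 fun _ : Fin d => L2 n))) =
      ⋂ φ : testSpace n, ⋂ j : Fin d, {p | ⟪contToL2 n (star (φ : C(Torus n, ℂ))), p.snd j⟫_ℂ =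
        -⟪contToL2 n (star (testGrad P j φ)), p.fst⟫_ℂ} := by
    ext p
    simp only [Set.mem_iInter, Set.mem_ofPred_eq, ← integral_mul_eq_inner]
    exact ⟨fun h φ j => h φ φ.2 j, fun h φ hφ j => h ⟨⟨φ, hφ.continuous⟩, hφ⟩ j⟩
  rw [h]
  exact isClosed_iInter fun φ => isClosed_iInter fun j =>
    isClosed_eq (continuous_const.inner (by fun_prop)) (continuous_const.inner (by fun_prop)).neg

instance instCompleteSpaceH1P : CompleteSpace (H1P P) := (isClosed_H1P P).completeSpace_coe

/-- The bounded operator `U ↦ U` from `H¹_P` to `L²`. -/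
def toL2CLM : H1P P →L[ℂ] L2 n := WithLp.fstL 2 ℂ _ _ ∘L (H1P P).subtypeL

/-- The bounded operator `U ↦ (P∇U)_j` from `H¹_P` to `L²`. -/
def weakGradCLM (j : Fin d) : H1P P →L[ℂ] L2 n :=
  PiLp.proj 2 (fun _ : Fin d => L2 n) j ∘L WithLp.sndL 2 ℂ _ _ ∘L (H1P P).subtypeL

variable {P}

theorem inner_H1P (U V : H1P P) :
    ⟪U, V⟫_ℂ = ⟪toL2 U, toL2 V⟫_ℂ + ∑ j, ⟪weakGrad U j, weakGrad V j⟫_ℂ := by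
  rw [Submodule.coe_inner, WithLp.prod_inner_apply, PiLp.inner_apply]
  rfl

theorem norm_sq_H1P (U : H1P P) : ‖U‖ ^ 2 = ‖toL2 U‖ ^ 2 + ∑ j, ‖weakGrad U j‖ ^ 2 := by
  rw [Submodule.coe_norm, WithLp.prod_norm_sq_eq_of_L2, PiLp.norm_sq_eq_of_L2]
  rfl

theorem norm_weakGrad_le (U : H1P P) (j : Fin d) : ‖weakGrad U j‖ ≤ ‖U‖ := by
  refine le_of_sq_le_sq ((norm_sq_H1P U).ge.trans' ?_) (norm_nonneg _)
  exact (Finset.single_le_sum (f := fun j => ‖weakGrad U j‖ ^ 2) (fun _ _ => sq_nonneg _)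
    (Finset.mem_univ j)).trans (le_add_of_nonneg_left (sq_nonneg _))

theorem integral_weakGrad_mul_character (U : H1P P) (k : Fin n → ℤ) (j : Fin d) :
    ∫ y, weakGrad U j y * character k y ∂(torusMeasure n) =
      -(symbol P k j * ∫ y, toL2 U y * character k y ∂(torusMeasure n)) := by
  rw [← integral_const_mul]
  have h := U.2 (character k) (isTestFunction_character k) j
  simp only [projGrad_character, mul_left_comm _ (symbol P k j)] at h
  exact h

theorem eq_zero_of_toL2_eq_zero {U : H1P P} (h : toL2 U = 0) : U = 0 := by
  have hgrad : ∀ j, weakGrad U j = 0 := fun j =>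
    eq_zero_of_integral_mul_character_eq_zero fun k => by
      rw [integral_weakGrad_mul_character, h, integral_eq_zero_of_ae, mul_zero, neg_zero]
      filter_upwards [Lp.coeFn_zero ℂ 2 (torusMeasure n)] with y hy
      rw [hy, Pi.zero_apply, zero_mul]
  exact Subtype.ext (WithLp.ofLp_injective 2 (Prod.ext h (PiLp.ext hgrad)))

end HilbertSpace

section TrigPoly

/-- The character `exp(i kᵀ y)` as an element of the space of smooth functions. -/
def charTest (k : Fin n → ℤ) : testSpace n := ⟨character k, isTestFunction_character k⟩

theorem testGrad_charTest (k : Fin n → ℤ) (j : Fin d) :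
    testGrad P j (charTest k) = symbol P k j • character k :=
  ContinuousMap.ext fun y => projGrad_character P k y j

/-- The trigonometric polynomials, as a subspace of the space of smooth functions. -/
def trigPoly (n : ℕ) : Submodule ℂ (testSpace n) := Submodule.span ℂ (Set.range charTest)

theorem inner_embed_charTest (U : H1P P) (k : Fin n → ℤ) :
    ⟪embed P (charTest k), U⟫_ℂ =
      (1 + ∑ j, ‖symbol P k j‖ ^ 2 : ℝ) * ∫ y, toL2 U y * character (-k) y ∂(torusMeasure n) := by
  have hgrad : ∀ j, ⟪weakGrad (embed P (charTest k)) j, weakGrad U j⟫_ℂ =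
      (‖symbol P k j‖ ^ 2 : ℝ) * ∫ y, toL2 U y * character (-k) y ∂(torusMeasure n) := fun j => by
    rw [weakGrad_embed, testGrad_charTest, map_smul, inner_smul_left, inner_toLp_character,
      integral_weakGrad_mul_character, symbol_neg, neg_mul, neg_neg, ← mul_assoc,
      Complex.conj_mul']
    push_cast
    rfl
  have hval : ⟪toL2 (embed P (charTest k)), toL2 U⟫_ℂ =
      ∫ y, toL2 U y * character (-k) y ∂(torusMeasure n) := inner_toLp_character k (toL2 U)
  rw [inner_H1P, hval, Finset.sum_congr rfl fun j _ => hgrad j, ← Finset.sum_mul]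
  push_cast
  ring

/-- Orthogonality to the characters in `H¹_P` is orthogonality in `L²`, since the characters are
eigenfunctions of `P∇`. -/
theorem dense_embed_trigPoly : Dense (embed P '' trigPoly n) := by
  change Dense ((trigPoly n).map (embed P) : Set (H1P P))
  rw [Submodule.dense_iff_topologicalClosure_eq_top,
    Submodule.topologicalClosure_eq_top_iff (𝕜 := ℂ) (E := H1P P), Submodule.eq_bot_iff]
  refine fun U hU => eq_zero_of_toL2_eq_zero (eq_zero_of_integral_mul_character_eq_zero fun k => ?_)
  have hk := (Submodule.mem_orthogonal (𝕜 := ℂ) (E := H1P P) _ _).1 hU (embed P (charTest (-k)))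
    (Submodule.mem_map_of_mem (Submodule.subset_span ⟨-k, rfl⟩))
  rw [inner_embed_charTest, neg_neg] at hk
  refine (mul_eq_zero.1 hk).resolve_left (Complex.ofReal_ne_zero.2 ?_)
  positivity

end TrigPoly

end SobolevSpace

/-! ### The operators of the two forms -/

section FormOperator

variable {d n : ℕ} (P : Matrix (Fin d) (Fin n) ℝ) {𝒜 : Torus n → Matrix (Fin d) (Fin d) ℝ}
  (h𝒜 : Continuous 𝒜)

/-- Multiplication by a continuous function on `L²`. -/
def mulL2 (m : C(Torus n, ℂ)) : L2 n →L[ℂ] L2 n :=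
  (ContinuousLinearMap.mul ℂ ℂ).holderL (torusMeasure n) ⊤ 2 2
    (ContinuousMap.toLp (E := ℂ) ⊤ (torusMeasure n) ℂ m)

theorem coeFn_mulL2 (m : C(Torus n, ℂ)) (U : L2 n) :
    mulL2 m U =ᵐ[torusMeasure n] fun y => m y * U y := by
  filter_upwards [(ContinuousLinearMap.mul ℂ ℂ).coeFn_holder
    (ContinuousMap.toLp (E := ℂ) ⊤ (torusMeasure n) ℂ m) U (r := 2),
    ContinuousMap.coeFn_toLp (p := ⊤) (𝕜 := ℂ) (torusMeasure n) m] with y hholder hm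
  refine hholder.trans ?_
  rw [hm]
  rfl

/-- The matrix entry `𝒜_{jl}` as a continuous complex function. -/
def entry (j l : Fin d) : C(Torus n, ℂ) :=
  ⟨fun y => (𝒜 y j l : ℂ), Complex.continuous_ofReal.comp (h𝒜.matrix_elem j l)⟩

/-- The bounded operator `U ↦ (𝒜 P∇U)_j` from `H¹_P` to `L²`. -/
def flux (j : Fin d) : H1P P →L[ℂ] L2 n := ∑ l, mulL2 (entry h𝒜 j l) ∘L weakGradCLM P l

/-- The operator on `H¹_P` that represents the form `(U, V)`. -/
def massOp : H1P P →L[ℂ] H1P P :=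
  ContinuousLinearMap.adjoint (𝕜 := ℂ) (E := H1P P) (F := L2 n) (toL2CLM P) ∘L toL2CLM P

/-- The operator on `H¹_P` that represents the form `a`. -/
def formOp : H1P P →L[ℂ] H1P P :=
  ∑ j, ContinuousLinearMap.adjoint (𝕜 := ℂ) (E := H1P P) (F := L2 n) (weakGradCLM P j) ∘L
    flux P h𝒜 j + massOp P

variable {P}

theorem coeFn_flux (j : Fin d) (U : H1P P) :
    flux P h𝒜 j U =ᵐ[torusMeasure n] fun y => ∑ l, (𝒜 y j l : ℂ) * weakGrad U l y := by
  have hflux : flux P h𝒜 j U = ∑ l, mulL2 (entry h𝒜 j l) (weakGrad U l) :=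
    _root_.sum_apply _ _ _
  rw [hflux]
  filter_upwards [Lp.coeFn_finsetSum Finset.univ fun l => mulL2 (entry h𝒜 j l) (weakGrad U l),
    ae_all_iff.2 fun l => coeFn_mulL2 (entry h𝒜 j l) (weakGrad U l)] with y hsum hmul
  rw [hsum, Finset.sum_apply]
  exact Finset.sum_congr rfl fun l _ => hmul l

theorem inner_massOp (U V : H1P P) : ⟪V, massOp P U⟫_ℂ = innerL2 (toL2 U) (toL2 V) :=
  ContinuousLinearMap.adjoint_inner_right (𝕜 := ℂ) (E := H1P P) (F := L2 n) _ _ _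

theorem inner_formOp (U V : H1P P) : ⟪V, formOp P h𝒜 U⟫_ℂ =
    ∑ j, ⟪weakGrad V j, flux P h𝒜 j U⟫_ℂ + ⟪toL2 V, toL2 U⟫_ℂ := by
  simp only [formOp, _root_.add_apply, _root_.sum_apply, ContinuousLinearMap.comp_apply,
    inner_add_right (𝕜 := ℂ) (E := H1P P), inner_sum (𝕜 := ℂ) (E := H1P P), inner_massOp]
  congr 1
  exact Finset.sum_congr rfl fun j _ =>
    ContinuousLinearMap.adjoint_inner_right (𝕜 := ℂ) (E := H1P P) (F := L2 n) _ _ _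

theorem inner_formOp_eq_formA (U V : H1P P) : ⟪V, formOp P h𝒜 U⟫_ℂ = formA P 𝒜 U V := by
  rw [inner_formOp, formA]
  congr 1
  refine Finset.sum_congr rfl fun j _ => integral_congr_ae ?_
  filter_upwards [coeFn_flux h𝒜 j U] with y hy
  rw [hy, RCLike.inner_apply]

theorem isSymmetric_massOp :
    LinearMap.IsSymmetric (𝕜 := ℂ) (E := H1P P) (massOp P).toLinearMap := fun U V => by
  change ⟪massOp P U, V⟫_ℂ = ⟪U, massOp P V⟫_ℂ
  rw [← inner_conj_symm (𝕜 := ℂ) (E := H1P P), inner_massOp, inner_massOp]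
  simp only [innerL2, ← integral_conj, map_mul, Complex.conj_conj, mul_comm]

theorem isSolutionOperator_iff (K : H1P P →L[ℂ] H1P P) :
    IsSolutionOperator P 𝒜 K ↔ formOp P h𝒜 * K = massOp P := by
  simp only [IsSolutionOperator, ← inner_formOp_eq_formA h𝒜, ← inner_massOp]
  refine ⟨fun h => ContinuousLinearMap.ext fun F => ext_inner_left (𝕜 := ℂ) (E := H1P P) fun V =>
    h F V, fun h F V => ?_⟩
  rw [← h]
  rfl

theorem existsUnique_isSolutionOperator (hA : IsUnit (formOp P h𝒜)) :
    ∃! K : H1P P →L[ℂ] H1P P, IsSolutionOperator P 𝒜 K := by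
  obtain ⟨u, hu⟩ := hA
  simp only [isSolutionOperator_iff h𝒜, ← hu]
  exact ⟨(↑u⁻¹ : H1P P →L[ℂ] H1P P) * massOp P, Units.mul_inv_cancel_left u _,
    fun K hK => by rw [← hK, Units.inv_mul_cancel_left]⟩

end FormOperator

/-! ### Trigonometric polynomials on the grid -/

section TrigSpace

variable {d n N : ℕ}

theorem trigSpace_le_testSpace (n N : ℕ) : trigSpace n N ≤ testSpace n := by
  refine Submodule.span_le.2 ?_
  rintro _ ⟨k, -, rfl⟩
  exact isTestFunction_character k

/-- The inclusion of `V^N` into the smooth functions. -/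
def trigIncl (n N : ℕ) : trigSpace n N →ₗ[ℂ] testSpace n :=
  Submodule.inclusion (trigSpace_le_testSpace n N)

theorem trigIncl_injective : Function.Injective (trigIncl n N) :=
  Submodule.inclusion_injective _

theorem testGrad_trigIncl_mem (P : Matrix (Fin d) (Fin n) ℝ) (j : Fin d) (U : trigSpace n N) :
    testGrad P j (trigIncl n N U) ∈ trigSpace n N := by
  obtain ⟨f, hf⟩ := U
  change (testGrad P j ∘ₗ trigIncl n N) ⟨f, hf⟩ ∈ trigSpace n N
  induction hf using Submodule.span_induction with
  | mem f hf =>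
    obtain ⟨k, hk, rfl⟩ := hf
    exact (testGrad_charTest P k j).symm ▸
      Submodule.smul_mem _ _ (Submodule.subset_span ⟨k, hk, rfl⟩)
  | zero => exact (map_zero (testGrad P j ∘ₗ trigIncl n N)).symm ▸ Submodule.zero_mem _
  | add f g hf hg ihf ihg =>
    exact (map_add (testGrad P j ∘ₗ trigIncl n N) ⟨f, hf⟩ ⟨g, hg⟩).symm ▸
      Submodule.add_mem _ ihf ihg
  | smul c f hf ih =>
    exact (map_smul (testGrad P j ∘ₗ trigIncl n N) c ⟨f, hf⟩).symm ▸ Submodule.smul_mem _ c ih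

theorem finite_freqSet (n N : ℕ) : (freqSet n N).Finite := by
  refine (Set.finite_Icc (fun _ : Fin n => -(N : ℤ)) fun _ => (N : ℤ)).subset fun k hk => ?_
  have hN : (0 : ℝ) ≤ N := N.cast_nonneg
  have hlower : ∀ i, (-(N : ℝ)) ≤ k i := fun i => by linarith [(hk i).1, hN]
  have hupper : ∀ i, (k i : ℝ) ≤ N := fun i => by linarith [(hk i).2, hN]
  exact ⟨fun i => mod_cast hlower i, fun i => mod_cast hupper i⟩

instance instFiniteDimensionalTrigSpace (n N : ℕ) : FiniteDimensional ℂ (trigSpace n N) :=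
  FiniteDimensional.span_of_finite ℂ ((finite_freqSet n N).image _)

theorem eventually_mem_freqSet (k : Fin n → ℤ) : ∀ᶠ N : ℕ in atTop, k ∈ freqSet n N := by
  refine eventually_all.2 fun i => ?_
  filter_upwards [tendsto_natCast_atTop_atTop.eventually_gt_atTop (2 * |(k i : ℝ)|)] with N hN
  constructor
  · linarith [neg_abs_le (k i : ℝ)]
  · linarith [le_abs_self (k i : ℝ)]

theorem eventually_mem_trigSpace {f : C(Torus n, ℂ)}
    (hf : f ∈ Submodule.span ℂ (Set.range (character (n := n)))) :
    ∀ᶠ N in atTop, f ∈ trigSpace n N := by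
  induction hf using Submodule.span_induction with
  | mem f hf =>
    obtain ⟨k, rfl⟩ := hf
    filter_upwards [eventually_mem_freqSet k] with N hk
    exact Submodule.subset_span ⟨k, hk, rfl⟩
  | zero => exact Eventually.of_forall fun N => Submodule.zero_mem _
  | add f g _ _ hf hg => exact (hf.and hg).mono fun N h => Submodule.add_mem _ h.1 h.2
  | smul c f _ hf => exact hf.mono fun N h => Submodule.smul_mem _ c h

theorem eventually_exists_trigIncl_eq {φ : testSpace n} (hφ : φ ∈ trigPoly n) :
    ∀ᶠ N in atTop, ∃ U, trigIncl n N U = φ := by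
  have h := Submodule.mem_map_of_mem (f := (testSpace n).subtype) hφ
  rw [trigPoly, Submodule.map_span, ← Set.range_comp] at h
  exact (eventually_mem_trigSpace h).mono fun N hN => ⟨⟨φ, hN⟩, rfl⟩

end TrigSpace

section InnerGrid

variable {n N : ℕ}

/-- The discrete inner product as a sesquilinear form on the continuous functions, conjugate-linear
in its first argument: `gridForm n N G F = (F, G)_N`. -/
def gridForm (n N : ℕ) : C(Torus n, ℂ) →ₗ⋆[ℂ] C(Torus n, ℂ) →ₗ[ℂ] ℂ :=
  LinearMap.mk₂'ₛₗ (starRingEnd ℂ) (RingHom.id ℂ) (fun G F => innerGrid N F G)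
    (fun G G' F => by
      simp only [innerGrid, ContinuousMap.add_apply, map_add, mul_add, Finset.sum_add_distrib])
    (fun c G F => by
      simp only [innerGrid, ContinuousMap.smul_apply, smul_eq_mul, map_mul, Finset.mul_sum,
        mul_left_comm _ (conj c)])
    (fun G F F' => by
      simp only [innerGrid, ContinuousMap.add_apply, add_mul, mul_add, Finset.sum_add_distrib])
    (fun c G F => by
      simp only [innerGrid, ContinuousMap.smul_apply, smul_eq_mul, Finset.mul_sum, RingHom.id_apply,
        mul_assoc, mul_left_comm _ c])

theorem gridForm_apply (F G : C(Torus n, ℂ)) : gridForm n N G F = innerGrid N F G := rfl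

theorem sum_exp_eq_zero_of_not_dvd (hN : N ≠ 0) {k : ℤ} (hk : ¬ (N : ℤ) ∣ k) :
    ∑ j : Fin N, Complex.exp (Complex.I * ((k * (2 * π * ((j : ℕ) : ℝ) / N) : ℝ) : ℂ)) = 0 := by
  have hN' : (N : ℂ) ≠ 0 := Nat.cast_ne_zero.2 hN
  set z : ℂ := Complex.exp (2 * π * Complex.I * (k / N))
  have hterm : ∀ j : ℕ,
      Complex.exp (Complex.I * ((k * (2 * π * (j : ℝ) / N) : ℝ) : ℂ)) = z ^ j := fun j => by
    rw [← Complex.exp_nat_mul]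
    congr 1
    push_cast
    field_simp
  have hz_ne_one : z ≠ 1 := fun h => by
    obtain ⟨m, hm⟩ := Complex.exp_eq_one_iff.1 h
    rw [mul_comm (m : ℂ)] at hm
    have hkm := mul_left_cancel₀ Complex.two_pi_I_ne_zero hm
    rw [div_eq_iff hN'] at hkm
    exact hk ⟨m, by rw [mul_comm]; exact_mod_cast hkm⟩
  have hz_pow : z ^ N = 1 := by
    rw [← Complex.exp_nat_mul]
    exact Complex.exp_eq_one_iff.2 ⟨k, by field_simp⟩
  simp only [hterm]
  rw [Fin.sum_univ_eq_sum_range (fun j => z ^ j), geom_sum_eq hz_ne_one, hz_pow, sub_self, zero_div]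

theorem innerGrid_character_of_not_dvd (hN : N ≠ 0) {k l : Fin n → ℤ} {i : Fin n}
    (hi : ¬ (N : ℤ) ∣ k i - l i) : innerGrid N (character k) (character l) = 0 := by
  have hterm : ∀ j : Fin n → Fin N,
      character k (gridPoint j) * conj (character l (gridPoint j)) = ∏ i, Complex.exp
        (Complex.I * (((k i - l i : ℤ) * (2 * π * ((j i : ℕ) : ℝ) / N) : ℝ) : ℂ)) := fun j => by
    rw [← character_neg_apply, ← ContinuousMap.mul_apply, ← character_add, ← sub_eq_add_neg,
      gridPoint, character_toTorus, ← Complex.exp_sum, Complex.ofReal_sum, Finset.mul_sum]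
    rfl
  simp only [innerGrid, hterm]
  rw [← Fintype.prod_sum fun i (j : Fin N) => Complex.exp
    (Complex.I * (((k i - l i : ℤ) * (2 * π * ((j : ℕ) : ℝ) / N) : ℝ) : ℂ)),
    Finset.prod_eq_zero (Finset.mem_univ i) (sum_exp_eq_zero_of_not_dvd hN hi), mul_zero]

theorem innerGrid_self (N : ℕ) (F : Torus n → ℂ) : innerGrid N F F =
    (1 / (N : ℝ) ^ n * ∑ j : Fin n → Fin N, ‖F (gridPoint j)‖ ^ 2 : ℝ) := by
  simp only [innerGrid, Complex.mul_conj']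
  push_cast
  rfl

theorem innerGrid_character_self (hN : N ≠ 0) (k : Fin n → ℤ) :
    innerGrid N (character k) (character k) = 1 := by
  have hN' : (N : ℝ) ^ n ≠ 0 := pow_ne_zero _ (Nat.cast_ne_zero.2 hN)
  have hnorm : ∀ y, ‖character k y‖ = 1 := fun y => by
    rw [character_apply, norm_prod]
    exact Finset.prod_eq_one fun i _ => by rw [fourier_apply]; exact Circle.norm_coe _
  rw [innerGrid_self]
  simp [hnorm, hN']

theorem innerL2_character (k l : Fin n → ℤ) :
    innerL2 (character k) (character l) = if k = l then 1 else 0 := by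
  simp only [innerL2, ← character_neg_apply, ← ContinuousMap.mul_apply, ← character_add,
    integral_character, ← sub_eq_add_neg, sub_eq_zero]

theorem innerGrid_character (hN : N ≠ 0) {k l : Fin n → ℤ} (hk : k ∈ freqSet n N)
    (hl : l ∈ freqSet n N) :
    innerGrid N (character k) (character l) = if k = l then 1 else 0 := by
  split_ifs with h
  · rw [h, innerGrid_character_self hN]
  obtain ⟨i, hi⟩ := Function.ne_iff.1 h
  have hlt : |((k i - l i : ℤ) : ℝ)| < N := by
    have hki := hk i
    have hli := hl i
    push_cast
    rw [abs_lt]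
    constructor <;> linarith
  exact innerGrid_character_of_not_dvd hN fun hdvd =>
    hi (sub_eq_zero.1 (Int.eq_zero_of_abs_lt_dvd hdvd (mod_cast hlt)))

theorem gridForm_eq_inner (hN : N ≠ 0) {F G : C(Torus n, ℂ)} (hF : F ∈ trigSpace n N)
    (hG : G ∈ trigSpace n N) : gridForm n N G F = ⟪contToL2 n G, contToL2 n F⟫_ℂ := by
  induction hG, hF using Submodule.span_induction₂ with
  | mem_mem G F hG hF =>
    obtain ⟨l, hl, rfl⟩ := hG
    obtain ⟨k, hk, rfl⟩ := hF
    rw [gridForm_apply, inner_contToL2, innerGrid_character hN hk hl, innerL2_character]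
  | zero_left F _ => simp only [map_zero, LinearMap.zero_apply, inner_zero_left]
  | zero_right G _ => simp only [map_zero, inner_zero_right]
  | add_left G G' F _ _ _ h h' =>
    simp only [map_add, LinearMap.add_apply, inner_add_left, h, h']
  | add_right G F F' _ _ _ h h' => simp only [map_add, inner_add_right, h, h']
  | smul_left c G F _ _ h =>
    simp only [map_smulₛₗ, RingHom.id_apply, LinearMap.smul_apply, inner_smul_left, smul_eq_mul, h]
  | smul_right c G F _ _ h => simp only [map_smul, inner_smul_right, smul_eq_mul, h]

theorem norm_sq_contToL2 (hN : N ≠ 0) {F : C(Torus n, ℂ)} (hF : F ∈ trigSpace n N) :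
    ‖contToL2 n F‖ ^ 2 = 1 / (N : ℝ) ^ n * ∑ j : Fin n → Fin N, ‖F (gridPoint j)‖ ^ 2 := by
  rw [← inner_self_eq_norm_sq (𝕜 := ℂ), ← gridForm_eq_inner hN hF hF, gridForm_apply,
    innerGrid_self]
  exact Complex.ofReal_re _

theorem norm_gridForm_le (hN : N ≠ 0) (R : C(Torus n, ℂ)) {W : C(Torus n, ℂ)}
    (hW : W ∈ trigSpace n N) : ‖gridForm n N W R‖ ≤ ‖R‖ * ‖contToL2 n W‖ := by
  set S := 1 / (N : ℝ) ^ n * ∑ j : Fin n → Fin N, ‖W (gridPoint j)‖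
  have hS : S ≤ ‖contToL2 n W‖ := by
    refine le_of_sq_le_sq ?_ (norm_nonneg _)
    have hcs := sq_sum_le_card_mul_sum_sq (s := (Finset.univ : Finset (Fin n → Fin N)))
      (f := fun j => ‖W (gridPoint j)‖)
    rw [Finset.card_univ, Fintype.card_fun, Fintype.card_fin, Fintype.card_fin,
      Nat.cast_pow] at hcs
    rw [norm_sq_contToL2 hN hW, mul_pow]
    refine (mul_le_mul_of_nonneg_left hcs (by positivity)).trans_eq ?_
    field_simp
  refine le_trans ?_ (mul_le_mul_of_nonneg_left hS (norm_nonneg R))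
  rw [gridForm_apply, innerGrid, norm_mul, norm_div, norm_one, norm_pow, Complex.norm_natCast,
    mul_left_comm, Finset.mul_sum]
  refine mul_le_mul_of_nonneg_left ((norm_sum_le _ _).trans (Finset.sum_le_sum fun j _ => ?_))
    (by positivity)
  rw [norm_mul, RCLike.norm_conj]
  exact mul_le_mul_of_nonneg_right (R.norm_coe_le_norm _) (norm_nonneg _)

theorem norm_contToL2_le (R : C(Torus n, ℂ)) : ‖contToL2 n R‖ ≤ ‖R‖ := by
  have h : ‖contToL2 n‖ ≤ 1 :=
    (ContinuousMap.toLp_norm_le (p := 2) (μ := torusMeasure n) (𝕜 := ℂ)).trans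
      (by simp [measureUnivNNReal])
  exact ((contToL2 n).le_opNorm R).trans (mul_le_of_le_one_left (norm_nonneg _) h)

/-- Replace `G` by a nearby trigonometric polynomial, on which quadrature is exact; the remainder is
bounded in both inner products by its supremum norm. -/
theorem eventually_norm_inner_sub_gridForm_le (G : C(Torus n, ℂ)) {ε : ℝ} (hε : 0 < ε) :
    ∀ᶠ N in atTop, ∀ W ∈ trigSpace n N,
      ‖⟪contToL2 n W, contToL2 n G⟫_ℂ - gridForm n N W G‖ ≤ ε * ‖contToL2 n W‖ := by
  have hG : G ∈ closure (Submodule.span ℂ (Set.range (character (n := n))) : Set _) := by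
    rw [← Submodule.topologicalClosure_coe, span_character_closure_eq_top]
    exact Set.mem_univ G
  obtain ⟨Q, hQ, hGQ⟩ := Metric.mem_closure_iff.1 hG (ε / 2) (half_pos hε)
  rw [dist_eq_norm] at hGQ
  filter_upwards [eventually_mem_trigSpace hQ, eventually_ne_atTop 0] with N hQN hN W hW
  have hsplit : ⟪contToL2 n W, contToL2 n G⟫_ℂ - gridForm n N W G =
      ⟪contToL2 n W, contToL2 n (G - Q)⟫_ℂ - gridForm n N W (G - Q) := by
    rw [map_sub, map_sub, inner_sub_right, gridForm_eq_inner hN hQN hW]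
    ring
  rw [hsplit]
  calc ‖⟪contToL2 n W, contToL2 n (G - Q)⟫_ℂ - gridForm n N W (G - Q)‖
      ≤ ‖contToL2 n W‖ * ‖contToL2 n (G - Q)‖ + ‖G - Q‖ * ‖contToL2 n W‖ :=
        (norm_sub_le _ _).trans
          (add_le_add (norm_inner_le_norm _ _) (norm_gridForm_le hN (G - Q) hW))
    _ ≤ ‖contToL2 n W‖ * ‖G - Q‖ + ‖G - Q‖ * ‖contToL2 n W‖ := by
        gcongr
        exact norm_contToL2_le (G - Q)
    _ = (2 * ‖G - Q‖) * ‖contToL2 n W‖ := by ring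
    _ ≤ ε * ‖contToL2 n W‖ := by gcongr; linarith

end InnerGrid

section HermitianForm

variable {m : Type*} [Fintype m]

theorem re_map_mulVec_dotProduct_star (M : Matrix m m ℝ) (ζ : m → ℂ) :
    ((M.map Complex.ofReal *ᵥ ζ) ⬝ᵥ star ζ).re =
      (fun j => (ζ j).re) ⬝ᵥ (M *ᵥ fun j => (ζ j).re) +
        (fun j => (ζ j).im) ⬝ᵥ (M *ᵥ fun j => (ζ j).im) := by
  simp only [dotProduct, Matrix.mulVec, Matrix.map_apply, Complex.re_sum, Pi.star_apply,
    RCLike.star_def, ← Finset.sum_add_distrib]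
  refine Finset.sum_congr rfl fun j _ => ?_
  simp only [Complex.mul_re, Complex.re_sum, Complex.im_sum, Complex.mul_im, Complex.ofReal_re,
    Complex.ofReal_im, Complex.conj_re, Complex.conj_im, zero_mul, sub_zero, add_zero]
  ring

theorem conj_map_mulVec_dotProduct_star {M : Matrix m m ℝ} (hM : M.IsSymm) (ζ η : m → ℂ) :
    conj ((M.map Complex.ofReal *ᵥ ζ) ⬝ᵥ star η) = (M.map Complex.ofReal *ᵥ η) ⬝ᵥ star ζ := by
  simp only [dotProduct, Matrix.mulVec, Matrix.map_apply, Pi.star_apply, RCLike.star_def, map_sum,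
    map_mul, Complex.conj_ofReal, Complex.conj_conj, Finset.sum_mul]
  rw [Finset.sum_comm]
  refine Finset.sum_congr rfl fun j _ => Finset.sum_congr rfl fun l _ => ?_
  rw [← hM.apply l j]
  ring

theorem mul_sum_norm_sq_le_re_map_mulVec {M : Matrix m m ℝ} {c : ℝ}
    (h : ∀ ξ : m → ℝ, c * (ξ ⬝ᵥ ξ) ≤ ξ ⬝ᵥ (M *ᵥ ξ)) (ζ : m → ℂ) :
    c * ∑ j, ‖ζ j‖ ^ 2 ≤ ((M.map Complex.ofReal *ᵥ ζ) ⬝ᵥ star ζ).re := by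
  have hnorm : ∑ j, ‖ζ j‖ ^ 2 = (fun j => (ζ j).re) ⬝ᵥ (fun j => (ζ j).re) +
      (fun j => (ζ j).im) ⬝ᵥ (fun j => (ζ j).im) := by
    simp only [dotProduct, ← Finset.sum_add_distrib, Complex.sq_norm, Complex.normSq_apply]
  rw [re_map_mulVec_dotProduct_star, hnorm, mul_add]
  exact add_le_add (h _) (h _)

theorem re_map_mulVec_le_sum_norm_mul (M : Matrix m m ℝ) (ζ : m → ℂ) :
    ((M.map Complex.ofReal *ᵥ ζ) ⬝ᵥ star ζ).re ≤ (∑ j, ∑ l, ‖M j l‖) * ∑ j, ‖ζ j‖ ^ 2 := by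
  have hle : ∀ j, ‖ζ j‖ ^ 2 ≤ ∑ j, ‖ζ j‖ ^ 2 := fun j =>
    Finset.single_le_sum (f := fun j => ‖ζ j‖ ^ 2) (fun _ _ => sq_nonneg _) (Finset.mem_univ j)
  have hprod : ∀ j l, ‖ζ l‖ * ‖ζ j‖ ≤ ∑ j, ‖ζ j‖ ^ 2 := fun j l => by
    nlinarith [hle j, hle l, sq_nonneg (‖ζ l‖ - ‖ζ j‖)]
  refine (Complex.re_le_norm _).trans ?_
  simp only [dotProduct, Matrix.mulVec, Matrix.map_apply, Finset.sum_mul]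
  refine norm_sum_le_of_le _ fun j _ => norm_sum_le_of_le _ fun l _ => ?_
  rw [Pi.star_apply, norm_mul, norm_mul, norm_star, Complex.norm_real, mul_assoc]
  exact mul_le_mul_of_nonneg_left (hprod j l) (norm_nonneg _)

end HermitianForm

section DiscreteForm

variable {d n : ℕ} (P : Matrix (Fin d) (Fin n) ℝ) {𝒜 : Torus n → Matrix (Fin d) (Fin d) ℝ}
  (h𝒜 : Continuous 𝒜) {N : ℕ}

/-- The `j`-th component of the classical `𝒜 P∇` as a linear map into the continuous functions. -/
def testFlux (j : Fin d) : testSpace n →ₗ[ℂ] C(Torus n, ℂ) :=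
  ∑ l, LinearMap.mulLeft ℂ (entry h𝒜 j l) ∘ₗ testGrad P l

theorem testFlux_apply (j : Fin d) (φ : testSpace n) (y : Torus n) :
    testFlux P h𝒜 j φ y = ∑ l, (𝒜 y j l : ℂ) * projGrad P φ y l := by
  simp only [testFlux, LinearMap.sum_apply, LinearMap.comp_apply, LinearMap.mulLeft_apply,
    ContinuousMap.sum_apply, ContinuousMap.mul_apply]
  rfl

theorem flux_embed (j : Fin d) (φ : testSpace n) :
    flux P h𝒜 j (embed P φ) = contToL2 n (testFlux P h𝒜 j φ) := by
  refine Lp.ext ?_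
  filter_upwards [coeFn_flux h𝒜 j (embed P φ), coeFn_contToL2 (testFlux P h𝒜 j φ),
    ae_all_iff.2 fun l => coeFn_contToL2 (testGrad P l φ)] with y hflux htest hgrad
  rw [hflux, htest, testFlux_apply]
  exact Finset.sum_congr rfl fun l _ => congrArg _ (hgrad l)

/-- The trial space `V^N` as a subspace of `H¹_P`. -/
def trigEmbed (N : ℕ) : trigSpace n N →ₗ[ℂ] H1P P :=
  embed P ∘ₗ trigIncl n N

theorem trigEmbed_injective : Function.Injective (trigEmbed P N) :=
  (embed_injective P).comp trigIncl_injective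

theorem weakGrad_trigEmbed (W : trigSpace n N) (j : Fin d) :
    weakGrad (trigEmbed P N W) j = contToL2 n (testGrad P j (trigIncl n N W)) :=
  weakGrad_embed _ _ _

/-- The discrete form as a sesquilinear form on `V^N`, conjugate-linear in its first argument:
`discreteForm P h𝒜 N W U = a_p(U, W)`. -/
def discreteForm (N : ℕ) : trigSpace n N →ₗ⋆[ℂ] trigSpace n N →ₗ[ℂ] ℂ :=
  ∑ j, (gridForm n N ∘ₛₗ (testGrad P j ∘ₗ trigIncl n N)).compl₂ (testFlux P h𝒜 j ∘ₗ trigIncl n N) +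
    (gridForm n N).domRestrict₁₂ _ _

theorem discreteForm_eq_sum (U W : trigSpace n N) : discreteForm P h𝒜 N W U =
    ∑ j, gridForm n N (testGrad P j (trigIncl n N W)) (testFlux P h𝒜 j (trigIncl n N U)) +
      gridForm n N (W : C(Torus n, ℂ)) U := by
  simp only [discreteForm, LinearMap.add_apply, LinearMap.sum_apply]
  rfl

theorem discreteForm_apply (U W : trigSpace n N) :
    discreteForm P h𝒜 N W U = formGrid P 𝒜 N (U : C(Torus n, ℂ)) (W : C(Torus n, ℂ)) := by
  simp only [discreteForm_eq_sum, gridForm_apply, innerGrid, testFlux_apply]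
  rfl

theorem formGrid_eq_sum (𝒜 : Torus n → Matrix (Fin d) (Fin d) ℝ) (N : ℕ) (U V : Torus n → ℂ) :
    formGrid P 𝒜 N U V = 1 / (N : ℂ) ^ n * ∑ j : Fin n → Fin N,
      (((𝒜 (gridPoint j)).map Complex.ofReal *ᵥ projGrad P U (gridPoint j)) ⬝ᵥ
        star (projGrad P V (gridPoint j)) + U (gridPoint j) * conj (V (gridPoint j))) := by
  simp only [formGrid, innerGrid]
  rw [← Finset.mul_sum, Finset.sum_comm, ← mul_add, ← Finset.sum_add_distrib]
  rfl

theorem conj_formGrid (hsymm : ∀ y, (𝒜 y).IsSymm) (U V : Torus n → ℂ) :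
    conj (formGrid P 𝒜 N U V) = formGrid P 𝒜 N V U := by
  simp only [formGrid_eq_sum, map_mul, map_sum, map_add, conj_map_mulVec_dotProduct_star (hsymm _),
    map_div₀, map_one, map_pow, map_natCast, Complex.conj_conj, mul_comm]

theorem re_formGrid_self (𝒜 : Torus n → Matrix (Fin d) (Fin d) ℝ) (N : ℕ) (U : Torus n → ℂ) :
    (formGrid P 𝒜 N U U).re = 1 / (N : ℝ) ^ n * ∑ j : Fin n → Fin N,
      ((((𝒜 (gridPoint j)).map Complex.ofReal *ᵥ projGrad P U (gridPoint j)) ⬝ᵥ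
        star (projGrad P U (gridPoint j))).re + ‖U (gridPoint j)‖ ^ 2) := by
  have hcast : 1 / (N : ℂ) ^ n = (1 / (N : ℝ) ^ n : ℝ) := by push_cast; rfl
  rw [formGrid_eq_sum, hcast, Complex.re_ofReal_mul, Complex.re_sum]
  simp only [Complex.add_re, Complex.mul_conj, Complex.normSq_eq_norm_sq, Complex.ofReal_re]

theorem norm_sq_trigEmbed (hN : N ≠ 0) (U : trigSpace n N) :
    ‖trigEmbed P N U‖ ^ 2 = 1 / (N : ℝ) ^ n * ∑ j : Fin n → Fin N,
      (∑ l, ‖projGrad P (U : C(Torus n, ℂ)) (gridPoint j) l‖ ^ 2 +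
        ‖(U : C(Torus n, ℂ)) (gridPoint j)‖ ^ 2) := by
  rw [trigEmbed, LinearMap.comp_apply, norm_sq_H1P, toL2_embed, Finset.sum_add_distrib,
    mul_add, add_comm]
  congr 1
  · rw [Finset.sum_comm, Finset.mul_sum]
    exact Finset.sum_congr rfl fun l _ => norm_sq_contToL2 hN (testGrad_trigIncl_mem P l U)
  · exact norm_sq_contToL2 hN U.2

theorem isEllipticForm_discreteForm (hsymm : ∀ y, (𝒜 y).IsSymm) {c : ℝ}
    (hc : ∀ (y : Torus n) (ξ : Fin d → ℝ), c * (ξ ⬝ᵥ ξ) ≤ ξ ⬝ᵥ (𝒜 y *ᵥ ξ)) (hN : N ≠ 0) :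
    IsEllipticForm (𝕜 := ℂ) (E := H1P P) (trigEmbed P N) (discreteForm P h𝒜 N) (min c 1)
      (max (∑ j, ∑ l, ‖entry h𝒜 j l‖) 1) where
  isSymm := ⟨fun U W => by simp only [discreteForm_apply, conj_formGrid P hsymm]⟩
  lower U := by
    rw [discreteForm_apply, norm_sq_trigEmbed P hN]
    refine le_of_le_of_eq ?_ (re_formGrid_self P 𝒜 N _).symm
    rw [mul_left_comm, Finset.mul_sum]
    refine mul_le_mul_of_nonneg_left (Finset.sum_le_sum fun j _ => ?_) (by positivity)
    rw [mul_add]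
    refine add_le_add (le_trans ?_ (mul_sum_norm_sq_le_re_map_mulVec (hc (gridPoint j)) _))
      (mul_le_of_le_one_left (sq_nonneg _) (min_le_right _ _))
    gcongr
    exact min_le_left _ _
  upper U := by
    rw [discreteForm_apply, norm_sq_trigEmbed P hN]
    refine le_of_eq_of_le (re_formGrid_self P 𝒜 N _) ?_
    rw [mul_left_comm, Finset.mul_sum _ _ (max _ (1 : ℝ))]
    refine mul_le_mul_of_nonneg_left (Finset.sum_le_sum fun j _ => ?_) (by positivity)
    rw [mul_add]
    refine add_le_add ((re_map_mulVec_le_sum_norm_mul _ _).trans ?_)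
      (le_mul_of_one_le_left (sq_nonneg _) (le_max_right _ _))
    gcongr
    refine le_trans ?_ (le_max_left _ _)
    gcongr with j _ l _
    rw [← Complex.norm_real]
    exact (entry h𝒜 j l).norm_coe_le_norm _

theorem eventually_norm_inner_formOp_sub_discreteForm_le (φ : testSpace n) {δ : ℝ} (hδ : 0 < δ) :
    ∀ᶠ N in atTop, ∀ U W : trigSpace n N, trigIncl n N U = φ →
      ‖⟪trigEmbed P N W, formOp P h𝒜 (embed P φ)⟫_ℂ - discreteForm P h𝒜 N W U‖ ≤
        δ * ‖trigEmbed P N W‖ := by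
  have hδ' : 0 < δ / (d + 1) := by positivity
  filter_upwards [eventually_all.2 fun j =>
    eventually_norm_inner_sub_gridForm_le (testFlux P h𝒜 j φ) hδ', eventually_ne_atTop 0]
  rintro N herr hN U W rfl
  have hj : ∀ j ∈ Finset.univ, ‖⟪weakGrad (trigEmbed P N W) j,
      flux P h𝒜 j (embed P (trigIncl n N U))⟫_ℂ -
        gridForm n N (testGrad P j (trigIncl n N W)) (testFlux P h𝒜 j (trigIncl n N U))‖ ≤
      δ / (d + 1) * ‖trigEmbed P N W‖ := fun j _ => by
    rw [weakGrad_trigEmbed, trigEmbed, LinearMap.comp_apply, flux_embed]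
    refine (herr j _ (testGrad_trigIncl_mem P j W)).trans ?_
    gcongr
    exact norm_weakGrad_le (trigEmbed P N W) j
  rw [inner_formOp, discreteForm_eq_sum, gridForm_eq_inner hN U.2 W.2]
  refine (congrArg norm (add_sub_add_right_eq_sub _ _ _)).trans_le ?_
  rw [← Finset.sum_sub_distrib]
  refine (norm_sum_le_of_le _ hj).trans ?_
  rw [Finset.sum_const, Finset.card_univ, Fintype.card_fin, nsmul_eq_mul, ← mul_assoc]
  gcongr
  rw [mul_div_assoc', div_le_iff₀ (by positivity)]
  nlinarith

theorem isGalerkinScheme_discreteForm (hsymm : ∀ y, (𝒜 y).IsSymm) {c : ℝ} (hc : 0 < c)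
    (hell : ∀ (y : Torus n) (ξ : Fin d → ℝ), c * (ξ ⬝ᵥ ξ) ≤ ξ ⬝ᵥ (𝒜 y *ᵥ ξ)) :
    IsGalerkinScheme (𝕜 := ℂ) (E := H1P P) atTop (formOp P h𝒜) (trigEmbed P) (discreteForm P h𝒜)
      (embed P '' trigPoly n) (min c 1)
      (max (∑ j, ∑ l, ‖entry h𝒜 j l‖) 1) where
  pos := lt_min hc one_pos
  elliptic := (eventually_ne_atTop 0).mono fun _ => isEllipticForm_discreteForm P h𝒜 hsymm hell
  injective := Eventually.of_forall fun _ => trigEmbed_injective P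
  dense := dense_embed_trigPoly P
  consistent := by
    rintro _ ⟨φ, hφ, rfl⟩ δ hδ
    filter_upwards [eventually_exists_trigIncl_eq hφ,
      eventually_norm_inner_formOp_sub_discreteForm_le P h𝒜 φ hδ]
    rintro N ⟨U, rfl⟩ herr
    exact ⟨U, rfl, fun W => herr U W rfl⟩

theorem existsUnique_isDiscreteSolutionOperator (h𝒜 : Continuous 𝒜)
    (hsymm : ∀ y, (𝒜 y).IsSymm) {c : ℝ} (hc : 0 < c)
    (hell : ∀ (y : Torus n) (ξ : Fin d → ℝ), c * (ξ ⬝ᵥ ξ) ≤ ξ ⬝ᵥ (𝒜 y *ᵥ ξ)) (hN : N ≠ 0) :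
    ∃! KN : Module.End ℂ (trigSpace n N), IsDiscreteSolutionOperator P 𝒜 N KN := by
  have hpos : IsPosDefHermitian (discreteForm P h𝒜 N) :=
    (isEllipticForm_discreteForm P h𝒜 hsymm hell hN).isPosDefHermitian (lt_min hc one_pos)
      (trigEmbed_injective P)
  have h := hpos.existsUnique_end ((gridForm n N).domRestrict₁₂ _ _)
  simp only [discreteForm_apply] at h
  exact h

theorem isGalerkinSolution_of_isDiscreteSolutionOperator
    {KN : ∀ N : ℕ, Module.End ℂ (trigSpace n N)}
    (hKN : ∀ N, 0 < N → IsDiscreteSolutionOperator P 𝒜 N (KN N)) :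
    IsGalerkinSolution (𝕜 := ℂ) (E := H1P P) atTop (massOp P) (trigEmbed P) (discreteForm P h𝒜)
      KN := by
  filter_upwards [eventually_gt_atTop 0] with N hN W U
  refine (discreteForm_apply P h𝒜 _ _).trans ((hKN N hN U W).trans ?_)
  rw [inner_massOp]
  exact (gridForm_eq_inner hN.ne' U.2 W.2).trans (L2.inner_def _ _)

end DiscreteForm

end QEO

end

theorem mainTheorem1_general (d n : ℕ) (P : Matrix (Fin d) (Fin n) ℝ)
    (𝒜 : QEO.Torus n → Matrix (Fin d) (Fin d) ℝ) (h𝒜 : Continuous 𝒜)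
    (hsymm : ∀ y, (𝒜 y).IsSymm) (C₀ : ℝ) (hC₀ : 0 < C₀)
    (hell : ∀ (y : QEO.Torus n) (ξ : Fin d → ℝ), C₀ * (ξ ⬝ᵥ ξ) ≤ ξ ⬝ᵥ (𝒜 y *ᵥ ξ)) :
    (∃! K : QEO.H1P P →L[ℂ] QEO.H1P P, QEO.IsSolutionOperator P 𝒜 K) ∧
    (∀ N : ℕ, 0 < N →
      ∃! KN : Module.End ℂ (QEO.trigSpace n N), QEO.IsDiscreteSolutionOperator P 𝒜 N KN) ∧
    ∀ (K : QEO.H1P P →L[ℂ] QEO.H1P P) (KN : ∀ N : ℕ, Module.End ℂ (QEO.trigSpace n N)),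
      QEO.IsSolutionOperator P 𝒜 K →
      (∀ N : ℕ, 0 < N → QEO.IsDiscreteSolutionOperator P 𝒜 N (KN N)) →
      ∀ γ ∈ spectrum ℂ K,
        Tendsto (fun N : ℕ => Metric.infEDist γ (spectrum ℂ (KN N))) atTop (𝓝 0) := by
  have hscheme := QEO.isGalerkinScheme_discreteForm P h𝒜 hsymm hC₀ hell
  refine ⟨?_, fun N hN => ?_, fun K KN hK hKN γ hγ => ?_⟩
  · exact QEO.existsUnique_isSolutionOperator h𝒜
      (QEO.isUnit_of_coercive (𝕜 := ℂ) (E := QEO.H1P P) hscheme.pos hscheme.coercive)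
  · exact QEO.existsUnique_isDiscreteSolutionOperator P h𝒜 hsymm hC₀ hell hN.ne'
  · exact hscheme.tendsto_infEDist_spectrum QEO.isSymmetric_massOp
      ((QEO.isSolutionOperator_iff h𝒜 K).1 hK)
      (QEO.isGalerkinSolution_of_isDiscreteSolutionOperator P h𝒜 hKN) hγ

theorem mainTheorem1 (d n : ℕ) (P : Matrix (Fin d) (Fin n) ℝ) (hP : QEO.IsProjectionMatrix P)
    (𝒜 : QEO.Torus n → Matrix (Fin d) (Fin d) ℝ) (h𝒜 : Continuous 𝒜)
    (α : (Fin d → ℝ) → Matrix (Fin d) (Fin d) ℝ)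
    (hα : ∀ x : Fin d → ℝ, α x = 𝒜 (QEO.toTorus (Pᵀ *ᵥ x)))
    (hsymm : ∀ x : Fin d → ℝ, (α x).IsSymm)
    (C₀ C₁ : ℝ) (hC₀ : 0 < C₀) (hC₁ : 0 < C₁)
    (hell : ∀ x ξ : Fin d → ℝ,
      C₀ * (ξ ⬝ᵥ ξ) ≤ ξ ⬝ᵥ (α x *ᵥ ξ) ∧ ξ ⬝ᵥ (α x *ᵥ ξ) ≤ C₁ * (ξ ⬝ᵥ ξ)) :
    (∃! K : QEO.H1P P →L[ℂ] QEO.H1P P, QEO.IsSolutionOperator P 𝒜 K) ∧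
    (∀ N : ℕ, 0 < N →
      ∃! KN : Module.End ℂ (QEO.trigSpace n N), QEO.IsDiscreteSolutionOperator P 𝒜 N KN) ∧
    ∀ (K : QEO.H1P P →L[ℂ] QEO.H1P P) (KN : ∀ N : ℕ, Module.End ℂ (QEO.trigSpace n N)),
      QEO.IsSolutionOperator P 𝒜 K →
      (∀ N : ℕ, 0 < N → QEO.IsDiscreteSolutionOperator P 𝒜 N (KN N)) →
      ∀ γ ∈ spectrum ℂ K,
        Tendsto (fun N : ℕ => Metric.infEDist γ (spectrum ℂ (KN N))) atTop (𝓝 0) := by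
  have horbit := QEO.denseRange_toTorus_transpose_mulVec hP.1
  exact mainTheorem1_general d n P 𝒜 h𝒜
    (QEO.isSymm_of_denseRange horbit h𝒜 fun x => hα x ▸ hsymm x) C₀ hC₀
    (QEO.mul_dotProduct_le_of_denseRange horbit h𝒜 fun x ξ => hα x ▸ (hell x ξ).1)
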